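/- Let $\mathcal T$ be a homogeneous tree of order $q\ge 1$ (an acyclic, connected, undirected graph in which every node belongs to exactly $q+1$ edges) with a fixed boundary point $\infty_{\mathcal T}$, that is, an equivalence class of infinite non-backtracking paths modulo finitely many edges. For nodes $s,t$ let $s\wedge t$ be the first node at which the representatives of $\infty_{\mathcal T}$ beginning at $s$ and at $t$ meet, and write $s\preceq t$ (resp. $s\asymp t$) if $\operatorname{dist}(s,s\wedge t)\le\operatorname{dist}(t,s\wedge t)$ (resp. $=$). Fix maps $\alpha_1,\dots,\alpha_q:\mathcal T\to\mathcal T$, acting on the right, with $\{t\alpha_1,\dots,t\alpha_q\}=\{s: t\preceq s,\ \operatorname{dist}(t,s)=1\}$ for every node $t$. Let $\mathcal F_q$ be the free semigroup of words in $\alpha_1,\dots,\alpha_q$, with unit $\emptyset$ and length $|w|$, acting on $\ell_2(\mathcal T)$ by $(wf)(t)=f(tw)$; $w^*$ is the adjoint operator, and $\chi_t$ are the standard basis vectors of $\ell_2(\mathcal T)$. A bounded operator $F$ on $\ell_2(\mathcal T)$ is causal if, for every node $s$, $f(t)=0$ for all $t\preceq s$ implies $(Ff)(t)=0$ for all $t\preceq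 s$. Let $\mathbf H(\mathcal T)$ be the algebra of causal operators, $\mathcal C=\{F: F,F^*\in\mathbf H(\mathcal T)\}$, $\mathbf H_2(\mathcal T)=\{F\in\mathbf H(\mathcal T): \|F\|_2^2=\operatorname{trace}(F^*F)<\infty\}$ and $\mathcal C_2=\mathcal C\cap\mathbf H_2(\mathcal T)$. For $F\in\mathbf H(\mathcal T)$ the coefficient $F_{[w]}\in\mathcal C$ is the operator with $(F_{[w]}\chi_t)(s)=(F\chi_t)(sw)$ if $t\asymp s$ and $0$ otherwise, and the point evaluation of $F$ at $c=(c_1,\dots,c_q)\in\mathcal C^q$ with $\lim_n\|(c\alpha)^n\|^{1/n}<1$, $c\alpha=\sum_jc_j\alpha_j$, is $F^\wedge(c)=\sum_{n\ge0}(c\alpha)^n\sum_{|w|=n}w^*F_{[w]}$; in particular $F^\wedge(0)=F_{[\emptyset]}$. Let $S\in\mathbf H(\mathcal T)$ be a Schur multiplier ($\|S\|\le1$), let $M_SF=SF$ on $\mathbf H_2(\mathcal T)$, $\mathcal B_S=I-M_SM_S^*$, let $\pi_S$ be the orthogonal projection of $\mathbf H_2(\mathcal T)$ onto $\ker\mathcal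 B_S$, and let $\mathbf H(S)=\sqrt{\mathcal B_S}\,\mathbf H_2(\mathcal T)$ with $\|\sqrt{\mathcal B_S}F\|_{\mathbf H(S)}=\|(I-\pi_S)F\|_2$ be the associated de Branges--Rovnyak space. Then the formulas $$A_jF=(F-F^\wedge(0))\alpha_j,\quad B_jd=(S-S^\wedge(0))d\alpha_j,\quad CF=F^\wedge(0),\quad Dd=S^\wedge(0)d$$ ($1\le j\le q$, $F\in\mathbf H(S)$, $d\in\mathcal C_2$) define bounded linear operators $A_j:\mathbf H(S)\to\mathbf H(S)$, $B_j:\mathcal C_2\to\mathbf H(S)$, $C:\mathbf H(S)\to\mathcal C_2$, $D:\mathcal C_2\to\mathcal C_2$, that is, bounded operators $V_j=\begin{pmatrix}A_j&B_j\\C&D\end{pmatrix}$ on $\mathbf H(S)\oplus\mathcal C_2$, and the following holds. Let $U\in\mathbf H_2(\mathcal T)$ and $Y=SU\in\mathbf H_2(\mathcal T)$. Then $U$ and $Y$ have unique pointwise absolutely convergent expansions $$U=\sum_{w\in\mathcal F_q}w^*U_{[w]},\qquad Y=\sum_{w\in\mathcal F_q}w^*Y_{[w]},\qquad U_{[w]},Y_{[w]}\in\mathcal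 C_2,$$ the operators $U_w=\sum_{|v|=|w|}v^*U_{[v]}w$ belong to $\mathcal C_2$, and with $X_w\in\mathbf H(S)$ given by the recursion $$X_\emptyset=0,\qquad X_{w\alpha_j}=A_jX_w+B_jU_w\qquad(w\in\mathcal F_q,\ 1\le j\le q)$$ one has $$Y_{[w]}=w(CX_v+DU_v)v^*\qquad\text{for all }w,v\in\mathcal F_q\text{ with }|v|=|w|.$$ -/

import Mathlib

namespace Multiscale

/-! ### Rays and boundary points of a tree -/

/-- An infinite path in a graph: consecutive nodes are joined by an edge and consecutive edges are
distinct. -/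
structure Ray {V : Type*} (G : SimpleGraph V) where
  node : ℕ → V
  adj : ∀ k, G.Adj (node k) (node (k + 1))
  ne : ∀ k, node k ≠ node (k + 2)

/-- Two rays coincide after deleting the first `m` edges of the one and the first `n` edges of the
other. -/
def Ray.Coincide {V : Type*} {G : SimpleGraph V} (r s : Ray G) (m n : ℕ) : Prop :=
  ∀ k, r.node (m + k) = s.node (n + k)

/-- Equivalence of rays: they coincide modulo a finite number of edges. -/
def Ray.setoid {V : Type*} (G : SimpleGraph V) : Setoid (Ray G) where
  r r s := ∃ m n, r.Coincide s m n
  iseqv :=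
    { refl := fun r => ⟨0, 0, fun _ => rfl⟩
      symm := fun ⟨m, n, h⟩ => ⟨n, m, fun k => (h k).symm⟩
      trans := by
        rintro r s u ⟨m, n, h⟩ ⟨m', n', h'⟩
        refine ⟨m + m', n' + n, fun k => ?_⟩
        have h1 := h (m' + k)
        have h2 := h' (n + k)
        rw [← add_assoc] at h1 h2
        rw [h1, ← add_assoc n' n k] at *
        rw [← h2]
        congr 1
        omega }

/-- Boundary points of a tree: equivalence classes of rays. -/
def Boundary {V : Type*} (G : SimpleGraph V) : Type _ := Quotient (Ray.setoid G)

/-- The boundary point represented by a ray. -/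
def Ray.toBoundary {V : Type*} {G : SimpleGraph V} (r : Ray G) : Boundary G :=
  Quotient.mk (Ray.setoid G) r

/-- The ray without its first `i` edges. -/
def Ray.drop {V : Type*} {G : SimpleGraph V} (r : Ray G) (i : ℕ) : Ray G where
  node k := r.node (i + k)
  adj k := r.adj (i + k)
  ne k := r.ne (i + k)

theorem Ray.exists_walk {V : Type*} {G : SimpleGraph V} (r : Ray G) (n : ℕ) :
    ∃ p : G.Walk (r.node 0) (r.node n),
      p.edges = (List.range n).map (fun k => s(r.node k, r.node (k + 1))) ∧
      p.support = (List.range (n + 1)).map r.node := by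
  induction n with
  | zero => exact ⟨SimpleGraph.Walk.nil, by simp, by simp⟩
  | succ n ih =>
    obtain ⟨p, h1, h2⟩ := ih
    refine ⟨p.concat (r.adj n), ?_, ?_⟩
    · rw [SimpleGraph.Walk.edges_concat, h1, List.range_succ]
      simp
    · rw [SimpleGraph.Walk.support_concat, h2, List.range_succ (n := n + 1)]
      simp

theorem Ray.exists_path {V : Type*} {G : SimpleGraph V} (hG : G.IsAcyclic) (r : Ray G) (n : ℕ) :
    ∃ p : G.Walk (r.node 0) (r.node n), p.IsPath ∧ p.support = (List.range (n + 1)).map r.node := by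
  obtain ⟨p, h1, h2⟩ := r.exists_walk n
  refine ⟨p, (hG.isPath_iff_isChain p).2 ?_, h2⟩
  rw [h1, List.isChain_iff_getElem]
  intro i hi
  simp only [List.getElem_map, List.getElem_range, ne_eq, Sym2.eq_iff, not_or, not_and]
  exact ⟨fun h => absurd h (r.adj i).ne, fun h => absurd h (r.ne i)⟩

/-- In a tree, two rays with the same origin that meet again agree up to the meeting point. -/
theorem Ray.agree {V : Type*} {G : SimpleGraph V} (hG : G.IsAcyclic) (r s : Ray G) {m n : ℕ}
    (h0 : r.node 0 = s.node 0) (h1 : r.node m = s.node n) :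
    m = n ∧ ∀ k ≤ m, r.node k = s.node k := by
  obtain ⟨p, hp, hp'⟩ := r.exists_path hG m
  obtain ⟨p2, hp2, hp2'⟩ := s.exists_path hG n
  have hc : (p.copy h0 h1).IsPath := by simpa using hp
  have := congrArg Subtype.val ((hG.subsingleton_path _ _).elim ⟨p.copy h0 h1, hc⟩ ⟨p2, hp2⟩)
  have h2 : p.support = p2.support := by
    have := congrArg SimpleGraph.Walk.support this
    simpa using this
  rw [hp', hp2'] at h2
  have h3 : m = n := by simpa using congrArg List.length h2
  subst h3
  refine ⟨rfl, fun k hk => ?_⟩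
  have := congrArg (fun l => l[k]?) h2
  simpa [List.getElem?_range (show k < m + 1 by omega)] using this

theorem Ray.injective {V : Type*} {G : SimpleGraph V} (hG : G.IsAcyclic) (r : Ray G) :
    Function.Injective r.node := by
  have key : ∀ i j, i ≤ j → r.node i = r.node j → i = j := by
    intro i j hij h
    have := ((r.drop i).agree hG (r.drop i) (m := j - i) (n := 0) rfl
      (by simp only [Ray.drop]; rw [Nat.add_sub_cancel' hij, Nat.add_zero, h])).1
    omega
  intro i j h
  rcases le_total i j with hij | hij
  · exact key i j hij h
  · exact (key j i hij h.symm).symm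

theorem Ray.toBoundary_eq {V : Type*} {G : SimpleGraph V} {r s : Ray G} :
    r.toBoundary = s.toBoundary ↔ ∃ m n, r.Coincide s m n :=
  ⟨fun h => Quotient.exact (s := Ray.setoid G) h, fun h => Quotient.sound (s := Ray.setoid G) h⟩

theorem Ray.exists_origin {V : Type*} {G : SimpleGraph V} (hG : G.IsTree) (ω : Boundary G) (t : V) :
    ∃ r : Ray G, r.toBoundary = ω ∧ r.node 0 = t := by
  obtain ⟨r₀, hr₀⟩ : ∃ r : Ray G, r.toBoundary = ω := Quotient.exists_rep (s := Ray.setoid G) ω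
  have key : ∀ s t : V, G.Walk t s → (∃ r : Ray G, r.toBoundary = ω ∧ r.node 0 = s) →
      ∃ r : Ray G, r.toBoundary = ω ∧ r.node 0 = t := by
    intro s t p
    induction p with
    | nil => exact id
    | @cons u v w huv p ih =>
      intro h
      obtain ⟨r, h1, h2⟩ := ih h
      by_cases hu : r.node 1 = u
      · refine ⟨r.drop 1, ?_, hu⟩
        rw [← h1, Ray.toBoundary_eq]
        exact ⟨0, 1, fun k => by simp [Ray.drop]⟩
      · refine ⟨⟨fun k => Nat.casesOn k u r.node, ?_, ?_⟩, ?_, rfl⟩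
        · rintro (_ | k)
          · simpa [h2] using huv
          · exact r.adj k
        · rintro (_ | k)
          · exact fun h => hu h.symm
          · exact r.ne k
        · rw [← h1, Ray.toBoundary_eq]
          exact ⟨1, 0, fun k => by simp only [Nat.add_comm 1 k, Nat.zero_add]⟩
  obtain ⟨p⟩ := hG.connected.preconnected t (r₀.node 0)
  exact key _ _ p ⟨r₀, hr₀, rfl⟩

/-- In a tree, a boundary point has only one representative with a given origin. -/
theorem Ray.eq_of_origin {V : Type*} {G : SimpleGraph V} (hG : G.IsTree) {r s : Ray G}
    (h : r.toBoundary = s.toBoundary) (h0 : r.node 0 = s.node 0) : r.node = s.node := by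
  obtain ⟨m, n, hmn⟩ := Ray.toBoundary_eq.1 h
  funext k
  exact (r.agree hG.isAcyclic s h0 (hmn k)).2 k (by omega)

/-! ### The homogeneous tree with its order and primitive shifts -/

/-- A homogeneous tree of order `q ≥ 1` (every node belongs to exactly `q + 1` edges) with a chosen
boundary point. -/
structure PointedTree (q : ℕ) (V : Type*) where
  one_le : 1 ≤ q
  graph : SimpleGraph V
  isTree : graph.IsTree
  encard_neighborSet : ∀ v, (graph.neighborSet v).encard = q + 1
  infty : Boundary graph

namespace PointedTree

variable {q : ℕ} {V : Type*} (T : PointedTree q V)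

/-- The unique representative of the chosen boundary point which begins at `t`. -/
noncomputable def ray (t : V) : Ray T.graph :=
  Classical.choose (Ray.exists_origin T.isTree T.infty t)

theorem ray_toBoundary (t : V) : (T.ray t).toBoundary = T.infty :=
  (Classical.choose_spec (Ray.exists_origin T.isTree T.infty t)).1

theorem ray_zero (t : V) : (T.ray t).node 0 = t :=
  (Classical.choose_spec (Ray.exists_origin T.isTree T.infty t)).2

/-- The minimal `n` such that the ray from `s` without its first `n` edges is a final part of the
ray from `t`, that is, the number of edges between `s` and `s ∧ t`. -/
noncomputable def steps (s t : V) : ℕ :=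
  sInf {n | ∃ m, (T.ray t).Coincide (T.ray s) m n}

/-- The node `s ∧ t` at which the rays from `s` and from `t` meet. -/
noncomputable def meet (s t : V) : V := (T.ray s).node (T.steps s t)

/-- The distance of two nodes. -/
noncomputable def dist (s t : V) : ℕ := T.steps s t + T.steps t s

/-- The order `s ≼ t`. -/
def le (s t : V) : Prop := T.dist s (T.meet s t) ≤ T.dist t (T.meet s t)

/-- The equivalence `s ≍ t`, whose classes are the horocycles. -/
def horo (s t : V) : Prop := T.dist s (T.meet s t) = T.dist t (T.meet s t)

theorem exists_coincide (s t : V) : ∃ m n, (T.ray t).Coincide (T.ray s) m n :=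
  Ray.toBoundary_eq.1 ((T.ray_toBoundary t).trans (T.ray_toBoundary s).symm)

theorem coincide_add {s t : V} {m n m' n' : ℕ} (h : (T.ray t).Coincide (T.ray s) m n)
    (h' : (T.ray t).Coincide (T.ray s) m' n') : m + n' = m' + n := by
  have h1 := h m'
  have h2 := h' m
  rw [Nat.add_comm m' m, h1] at h2
  have := (T.ray s).injective T.isTree.isAcyclic h2
  omega

/-- The two minimal numbers are attained simultaneously. -/
theorem coincide_steps (s t : V) : (T.ray t).Coincide (T.ray s) (T.steps t s) (T.steps s t) := by
  obtain ⟨m, n, h⟩ := T.exists_coincide s t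
  obtain ⟨m₁, h₁⟩ : T.steps s t ∈ {n | ∃ m, (T.ray t).Coincide (T.ray s) m n} :=
    Nat.sInf_mem ⟨n, m, h⟩
  obtain ⟨n₂, h₂⟩ : T.steps t s ∈ {n | ∃ m, (T.ray s).Coincide (T.ray t) m n} :=
    Nat.sInf_mem ⟨m, n, fun k => (h k).symm⟩
  have h₂' : (T.ray t).Coincide (T.ray s) (T.steps t s) n₂ := fun k => (h₂ k).symm
  have e := T.coincide_add h₁ h₂'
  have l1 : T.steps s t ≤ n₂ := Nat.sInf_le ⟨_, h₂'⟩
  have l2 : T.steps t s ≤ m₁ := Nat.sInf_le ⟨_, fun k => (h₁ k).symm⟩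
  have : m₁ = T.steps t s := by omega
  rwa [this] at h₁

theorem ray_node (t : V) (i k : ℕ) : (T.ray ((T.ray t).node i)).node k = (T.ray t).node (i + k) := by
  have h : (T.ray ((T.ray t).node i)).toBoundary = ((T.ray t).drop i).toBoundary := by
    rw [ray_toBoundary, ← T.ray_toBoundary t, Ray.toBoundary_eq]
    exact ⟨i, 0, fun k => by simp [Ray.drop]⟩
  have := Ray.eq_of_origin T.isTree h (by rw [ray_zero]; rfl)
  exact congrFun this k

theorem meet_comm (s t : V) : T.meet s t = T.meet t s := by
  have := T.coincide_steps s t 0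
  simpa [meet] using this.symm

theorem dist_ray (s : V) (n : ℕ) : T.dist s ((T.ray s).node n) = n := by
  set u := (T.ray s).node n with hu
  have h : (T.ray u).Coincide (T.ray s) 0 n := fun k => by
    rw [hu, T.ray_node, Nat.zero_add]
  have e := T.coincide_add h (T.coincide_steps s u)
  have l : T.steps u s ≤ 0 := Nat.sInf_le ⟨n, fun k => (h k).symm⟩
  unfold dist
  omega

theorem le_iff (s t : V) : T.le s t ↔ T.steps s t ≤ T.steps t s := by
  unfold le
  rw [meet, dist_ray, ← meet, meet_comm, meet, dist_ray]

theorem horo_iff (s t : V) : T.horo s t ↔ T.steps s t = T.steps t s := by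
  unfold horo
  rw [meet, dist_ray, ← meet, meet_comm, meet, dist_ray]

/-- The nodes above `t` at distance one have `t` as their predecessor on the ray. -/
theorem ray_one_of_le {t u : V} (h : T.le t u) (h1 : T.dist t u = 1) : (T.ray u).node 1 = t := by
  rw [le_iff] at h
  unfold dist at h1
  have h2 : T.steps t u = 0 := by omega
  have h3 : T.steps u t = 1 := by omega
  have := T.coincide_steps t u 0
  rw [h2, h3] at this
  simpa [ray_zero] using this

/-- The horocycles are the level sets of a function. -/
theorem exists_level : ∃ h : V → ℤ, ∀ s t, T.horo s t ↔ h s = h t := by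
  obtain ⟨o⟩ : Nonempty V := T.isTree.connected.nonempty
  refine ⟨fun s => (T.steps s o : ℤ) - T.steps o s, fun s t => ?_⟩
  have h1 := T.coincide_steps s o
  have h2 := T.coincide_steps t o
  have h3 := T.coincide_steps s t
  rw [horo_iff]
  have h4 : (T.ray o).Coincide (T.ray s) (T.steps o t + T.steps t s)
      (T.steps s t + T.steps t o) := fun k => by
    have e1 := h2 (T.steps t s + k)
    have e2 := h3 (T.steps t o + k)
    rw [add_assoc, e1, add_assoc, ← e2]
    congr 1
    omega
  have := T.coincide_add h1 h4
  dsimp only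
  omega

end PointedTree

/-- A pointed homogeneous tree with `q` primitive shifts: maps `α₁, …, α_q` of the set of nodes into
itself with `{t α₁, …, t α_q} = {s | t ≼ s, dist(t, s) = 1}` for every node `t`. -/
structure MultiscaleTree (q : ℕ) (V : Type*) extends PointedTree q V where
  shift : Fin q → V → V
  range_shift : ∀ t, Set.range (fun j => shift j t) =
    {s | toPointedTree.le t s ∧ toPointedTree.dist t s = 1}

/-! ### Operators on `ℓ₂` of the tree -/

/-- The Hilbert space `ℓ₂(𝒯)`. -/
abbrev L2 (V : Type*) : Type _ := lp (fun _ : V => ℂ) 2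

/-- The C*-algebra `𝐗(𝒯)` of bounded operators on `ℓ₂(𝒯)`. -/
abbrev Op (V : Type*) : Type _ := L2 V →L[ℂ] L2 V

open Classical in
/-- The standard basis vector `χ_t`. -/
noncomputable def chi {V : Type*} (t : V) : L2 V := lp.single 2 t 1

/-- The bounded operator on `ℓ₂` given by a linear map into functions that satisfies a bound. -/
noncomputable def opOfBound {V : Type*} (Φ : L2 V →ₗ[ℂ] (V → ℂ)) (C : ℝ) (hC : 0 ≤ C)
    (h : ∀ f (s : Finset V), ∑ t ∈ s, ‖Φ f t‖ ^ 2 ≤ (C * ‖f‖) ^ 2) : Op V :=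
  LinearMap.mkContinuous
    { toFun := fun f => ⟨Φ f, memℓp_gen' (C := (C * ‖f‖) ^ 2)
        (fun s => by simpa using h f s)⟩
      map_add' := fun f g => Subtype.ext (Φ.map_add f g)
      map_smul' := fun c f => Subtype.ext (Φ.map_smul c f) } C
    (fun f => lp.norm_le_of_forall_sum_le (by simp) (by positivity)
      (fun s => by simpa using h f s))

theorem opOfBound_apply {V : Type*} (Φ : L2 V →ₗ[ℂ] (V → ℂ)) (C : ℝ) (hC : 0 ≤ C)
    (h : ∀ f (s : Finset V), ∑ t ∈ s, ‖Φ f t‖ ^ 2 ≤ (C * ‖f‖) ^ 2) (f : L2 V) (t : V) :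
    opOfBound Φ C hC h f t = Φ f t := rfl

theorem sum_sq_le {V : Type*} (f : L2 V) (s : Finset V) : ∑ t ∈ s, ‖f t‖ ^ 2 ≤ ‖f‖ ^ 2 := by
  simpa using lp.sum_rpow_le_norm_rpow (p := 2) (by simp) f s

/-- Restriction of a function to a set of nodes. -/
noncomputable def proj {V : Type*} (A : Set V) : Op V :=
  opOfBound
    { toFun := fun f => A.indicator (fun t => f t)
      map_add' := fun f g => by
        funext t; by_cases ht : t ∈ A <;> simp [ht]
      map_smul' := fun c f => by
        funext t; by_cases ht : t ∈ A <;> simp [ht] } 1 zero_le_one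
    (fun f s => by
      rw [one_mul]
      refine le_trans (Finset.sum_le_sum fun t _ => ?_) (sum_sq_le f s)
      by_cases ht : t ∈ A <;> simp [ht])

theorem proj_apply {V : Type*} (A : Set V) (f : L2 V) (t : V) :
    proj A f t = A.indicator (fun t => f t) t := rfl

theorem norm_sq_eq {V : Type*} (f : L2 V) : HasSum (fun t => ‖f t‖ ^ 2) (‖f‖ ^ 2) := by
  simpa using lp.hasSum_norm (p := 2) (by simp) f

theorem sum_norm_proj_le {V : Type*} (h : V → ℤ) (f : L2 V) (N : Finset ℤ) :
    ∑ n ∈ N, ‖proj {r | h r = n} f‖ ^ 2 ≤ ‖f‖ ^ 2 := by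
  have h1 : HasSum (fun t => ∑ n ∈ N, ‖proj {r | h r = n} f t‖ ^ 2)
      (∑ n ∈ N, ‖proj {r | h r = n} f‖ ^ 2) := hasSum_sum fun n _ => norm_sq_eq _
  refine hasSum_le (fun t => ?_) h1 (norm_sq_eq f)
  have h2 : ∀ n, ‖proj {r | h r = n} f t‖ ^ 2 = if h t = n then ‖f t‖ ^ 2 else 0 := by
    intro n
    rw [proj_apply]
    by_cases hn : h t = n <;> simp [hn]
  simp only [h2, Finset.sum_ite_eq]
  split_ifs
  · exact le_rfl
  · positivity

namespace MultiscaleTree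

variable {q : ℕ} {V : Type*} (T : MultiscaleTree q V)

theorem shift_injective (j : Fin q) : Function.Injective (T.shift j) := by
  have key : ∀ t, (T.ray (T.shift j t)).node 1 = t := by
    intro t
    have : T.shift j t ∈ Set.range (fun j => T.shift j t) := ⟨j, rfl⟩
    rw [T.range_shift t] at this
    exact T.ray_one_of_le this.1 this.2
  intro s t h
  rw [← key s, h, key t]

/-- The primitive shift as an operator: `(α_j f)(t) = f(t α_j)`. -/
noncomputable def alpha (j : Fin q) : Op V :=
  opOfBound
    { toFun := fun f t => f (T.shift j t)
      map_add' := fun _ _ => rfl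
      map_smul' := fun _ _ => rfl } 1 zero_le_one
    (fun f s => by
      have := sum_sq_le f (s.map ⟨T.shift j, T.shift_injective j⟩)
      rw [Finset.sum_map] at this
      rw [one_mul]
      exact this)

/-- The operator of the word `w = α_{i₁} ⋯ α_{iₙ}`, an element of the free semigroup generated by
the primitive shifts: `(w f)(t) = f(t w)` with `t w = (⋯ (t α_{i₁}) ⋯) α_{iₙ}`. -/
noncomputable def word (w : List (Fin q)) : Op V := (w.map T.alpha).prod

/-- Causal operators, the elements of `𝐇(𝒯)`. -/
def Causal (S : Op V) : Prop :=
  ∀ (s : V) (f : L2 V), (∀ t, T.le t s → f t = 0) → ∀ t, T.le t s → S f t = 0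

/-- Constants, the elements of `𝒞`. -/
def IsConst (S : Op V) : Prop := T.Causal S ∧ T.Causal (star S)

/-- The part `F_[∅]` of an operator `F` which maps each horocycle into itself: at a node `t` of the
horocycle `𝔥` one has `(F_[∅] f)(t) = (F (f restricted to 𝔥))(t)`. Its matrix entries are
`(F_[∅] χ_t)(s) = (F χ_t)(s)` if `s ≍ t`, and `0` otherwise. -/
noncomputable def constPart (F : Op V) : Op V :=
  opOfBound
    { toFun := fun f t => F (proj {r | T.horo r t} f) t
      map_add' := fun f g => by funext t; simp
      map_smul' := fun c f => by funext t; simp } ‖F‖ (norm_nonneg F)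
    (fun f s => by
      obtain ⟨h, hh⟩ := T.exists_level
      simp only [hh, LinearMap.coe_mk, AddHom.coe_mk]
      classical
      rw [← Finset.sum_fiberwise_of_maps_to (g := h) (t := s.image h)
        (fun t ht => Finset.mem_image_of_mem h ht)]
      calc ∑ n ∈ s.image h, ∑ t ∈ s with h t = n, ‖F (proj {r | h r = h t} f) t‖ ^ 2
          ≤ ∑ n ∈ s.image h, (‖F‖ ^ 2 * ‖proj {r | h r = n} f‖ ^ 2) := by
            refine Finset.sum_le_sum fun n _ => ?_
            calc ∑ t ∈ s with h t = n, ‖F (proj {r | h r = h t} f) t‖ ^ 2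
                = ∑ t ∈ s with h t = n, ‖F (proj {r | h r = n} f) t‖ ^ 2 := by
                  refine Finset.sum_congr rfl fun t ht => ?_
                  rw [(Finset.mem_filter.1 ht).2]
              _ ≤ ‖F (proj {r | h r = n} f)‖ ^ 2 := sum_sq_le _ _
              _ ≤ (‖F‖ * ‖proj {r | h r = n} f‖) ^ 2 := by
                  gcongr
                  exact F.le_opNorm _
              _ = _ := mul_pow _ _ _
        _ ≤ ‖F‖ ^ 2 * ‖f‖ ^ 2 := by
            rw [← Finset.mul_sum]
            gcongr
            exact sum_norm_proj_le h f _
        _ = (‖F‖ * ‖f‖) ^ 2 := (mul_pow _ _ _).symm)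

/-- The coefficient `F_[w]`, with matrix entries `(F_[w] χ_t)(s) = (F χ_t)(s w)` if `s ≍ t`, and `0`
otherwise. -/
noncomputable def coeff (F : Op V) (w : List (Fin q)) : Op V := T.constPart (T.word w * F)

/-- The series `F = ∑_w w* a_w` with coefficients `a_w ∈ 𝒞`, convergent pointwise absolutely. -/
def IsExpansion (F : Op V) (a : List (Fin q) → Op V) : Prop :=
  (∀ w, T.IsConst (a w)) ∧ ∀ (f : L2 V) (t : V),
    Summable (fun w => ‖(star (T.word w) * a w) f t‖) ∧
      ∑' w, (star (T.word w) * a w) f t = F f t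

/-- The point evaluation `F^(c) = ∑_n (c α)^n ∑_{|w| = n} w* F_[w]` at `c = (c₁, …, c_q)`, where
`c α = c₁ α₁ + ⋯ + c_q α_q`. -/
noncomputable def pointEval (F : Op V) (c : Fin q → Op V) : Op V :=
  ∑' n : ℕ, (∑ j, c j * T.alpha j) ^ n *
    ∑ w : List.Vector (Fin q) n, star (T.word w.1) * T.coeff F w.1

/-! ### Hilbert–Schmidt operators -/

/-- The square summability `trace(F* F) = ∑_t ‖F χ_t‖² < ∞`. -/
def IsHilbertSchmidt {V : Type*} (F : Op V) : Prop := Summable fun t => ‖F (chi t)‖ ^ 2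

theorem IsHilbertSchmidt.memℓp {V : Type*} {F : Op V} (h : IsHilbertSchmidt F) :
    Memℓp (fun t => F (chi t)) 2 :=
  memℓp_gen (by simpa using (show Summable fun t => ‖F (chi t)‖ ^ 2 from h))

theorem isHilbertSchmidt_of_memℓp {V : Type*} {F : Op V} (h : Memℓp (fun t => F (chi t)) 2) :
    IsHilbertSchmidt F := by
  have := h.summable (by simp)
  unfold IsHilbertSchmidt
  simpa using this

theorem hasSum_chi {V : Type*} (f : L2 V) : HasSum (fun t => f t • chi t) f := by
  classical
  have h := lp.hasSum_single (p := 2) (by simp) f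
  convert h using 2 with t
  unfold chi
  rw [← lp.single_smul, smul_eq_mul, mul_one]

theorem op_ext {V : Type*} {F G : Op V} (h : ∀ t, F (chi t) = G (chi t)) : F = G := by
  ext1 f
  have h1 := (hasSum_chi f).mapL F
  have h2 := (hasSum_chi f).mapL G
  simp only [map_smul, h] at h1 h2
  exact h1.unique h2

/-- The operator norm is at most the Hilbert–Schmidt norm. -/
theorem norm_le_hilbertSchmidt {V : Type*} (F : Op V) (g : lp (fun _ : V => L2 V) 2)
    (h : ∀ t, g t = F (chi t)) : ‖F‖ ≤ ‖g‖ := by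
  refine F.opNorm_le_bound (norm_nonneg _) fun f => ?_
  have h1 := (hasSum_chi f).mapL F
  have hpq : (2 : ENNReal).toReal.HolderConjugate (2 : ENNReal).toReal := by
    simpa using Real.HolderConjugate.two_two
  have hs : Summable fun t => ‖f t‖ * ‖g t‖ := by
    simpa [lp.toNorm] using lp.summable_mul hpq (lp.toNorm f) (lp.toNorm g)
  have hle : ∑' t, ‖f t‖ * ‖g t‖ ≤ ‖f‖ * ‖g‖ := by
    have := lp.tsum_mul_le_mul_norm' hpq (lp.toNorm f) (lp.toNorm g)
    rw [lp.norm_toNorm, lp.norm_toNorm] at this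
    simpa [lp.toNorm] using this
  have h2 : ∀ t, F (f t • chi t) = f t • g t := fun t => by rw [map_smul, h]
  simp only [h2] at h1
  rw [← h1.tsum_eq, mul_comm]
  refine (norm_tsum_le_tsum_norm ?_).trans ?_
  · simpa only [norm_smul] using hs
  · simpa only [norm_smul] using hle

/-- The space `𝐇₂(𝒯)` of causal Hilbert–Schmidt operators, as a set of operators. -/
def hardyTwoSubmodule : Submodule ℂ (Op V) where
  carrier := {F | T.Causal F ∧ IsHilbertSchmidt F}
  zero_mem' := ⟨fun _ _ _ _ _ => rfl, by
    simp [IsHilbertSchmidt]⟩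
  add_mem' := by
    rintro F G ⟨h1, h2⟩ ⟨h3, h4⟩
    refine ⟨fun s f hf t ht => ?_, isHilbertSchmidt_of_memℓp (h2.memℓp.add h4.memℓp)⟩
    simp [h1 s f hf t ht, h3 s f hf t ht]
  smul_mem' := by
    rintro c F ⟨h1, h2⟩
    refine ⟨fun s f hf t ht => ?_, isHilbertSchmidt_of_memℓp (h2.memℓp.const_smul c)⟩
    simp [h1 s f hf t ht]

/-- The space `𝐇₂(𝒯)`, to be equipped with the Hilbert–Schmidt norm. -/
def HardyTwo : Type _ := T.hardyTwoSubmodule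

/-- The square summable family `(F χ_t)_t`. -/
noncomputable def columnMap : T.hardyTwoSubmodule →ₗ[ℂ] lp (fun _ : V => L2 V) 2 where
  toFun F := ⟨fun t => F.1 (chi t), F.2.2.memℓp⟩
  map_add' _ _ := rfl
  map_smul' _ _ := rfl

theorem columnMap_injective : Function.Injective T.columnMap := by
  intro F G h
  refine Subtype.ext (op_ext fun t => ?_)
  exact congrArg (fun g : lp (fun _ : V => L2 V) 2 => g t) h

namespace HardyTwo

/-- The norm `‖F‖₂ = (∑_t ‖F χ_t‖²)^{1/2}`. -/
noncomputable instance : NormedAddCommGroup T.HardyTwo :=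
  NormedAddCommGroup.induced T.hardyTwoSubmodule (lp (fun _ : V => L2 V) 2) T.columnMap
    T.columnMap_injective

/-- The inner product `∑_t ⟨F χ_t, G χ_t⟩`. -/
noncomputable instance : InnerProductSpace ℂ T.HardyTwo :=
  InnerProductSpace.induced (G := T.hardyTwoSubmodule) T.columnMap

/-- An element of `𝐇₂(𝒯)` as an operator. -/
noncomputable def op : T.HardyTwo →ₗ[ℂ] Op V where
  toFun F := F.1
  map_add' _ _ := rfl
  map_smul' _ _ := rfl

/-- The square summable family `(F χ_t)_t`. -/
noncomputable def columns : T.HardyTwo →ₗ[ℂ] lp (fun _ : V => L2 V) 2 where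
  toFun F := T.columnMap F
  map_add' _ _ := rfl
  map_smul' _ _ := rfl

variable {T}

theorem op_injective : Function.Injective (op T) := Subtype.val_injective

theorem causal_op (F : T.HardyTwo) : T.Causal (op T F) := F.2.1

theorem isHilbertSchmidt_op (F : T.HardyTwo) : IsHilbertSchmidt (op T F) := F.2.2

/-- The element of `𝐇₂(𝒯)` given by a causal Hilbert–Schmidt operator. -/
def mk (F : Op V) (h1 : T.Causal F) (h2 : IsHilbertSchmidt F) : T.HardyTwo := ⟨F, h1, h2⟩

theorem op_mk (F : Op V) (h1 : T.Causal F) (h2 : IsHilbertSchmidt F) :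
    op T (mk F h1 h2) = F := rfl

theorem columns_apply (F : T.HardyTwo) (t : V) : columns T F t = op T F (chi t) := rfl

theorem norm_eq (F : T.HardyTwo) : ‖F‖ = ‖columns T F‖ := rfl

theorem hasSum_norm_sq (F : T.HardyTwo) : HasSum (fun t => ‖op T F (chi t)‖ ^ 2) (‖F‖ ^ 2) := by
  simpa [norm_eq, columns_apply] using lp.hasSum_norm (p := 2) (by simp) (columns T F)

theorem norm_op_le (F : T.HardyTwo) : ‖op T F‖ ≤ ‖F‖ :=
  norm_le_hilbertSchmidt _ (columns T F) fun _ => rfl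

instance : CompleteSpace T.HardyTwo := by
  refine Metric.complete_of_cauchySeq_tendsto fun u hu => ?_
  have hc : Isometry (columns T) := AddMonoidHomClass.isometry_of_norm _ fun _ => rfl
  obtain ⟨g, hg⟩ := cauchySeq_tendsto_of_complete (hc.uniformContinuous.comp_cauchySeq hu)
  have hL : LipschitzWith 1 (op T) :=
    AddMonoidHomClass.lipschitz_of_bound_nnnorm _ 1 fun F => by
      rw [one_mul]; exact norm_op_le F
  obtain ⟨F, hF⟩ := cauchySeq_tendsto_of_complete (hL.uniformContinuous.comp_cauchySeq hu)
  have hFf : ∀ f, Filter.Tendsto (fun n => op T (u n) f) Filter.atTop (nhds (F f)) := fun f =>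
    ((ContinuousLinearMap.apply ℂ (L2 V) f).continuous.tendsto F).comp hF
  have hcol : ∀ t, F (chi t) = g t := fun t =>
    tendsto_nhds_unique (hFf (chi t))
      (((lp.evalCLM ℂ (fun _ : V => L2 V) 2 t).continuous.tendsto g).comp hg)
  have h1 : T.Causal F := fun s f hf t ht => by
    refine tendsto_nhds_unique
      (((lp.evalCLM ℂ (fun _ : V => ℂ) 2 t).continuous.tendsto (F f)).comp (hFf f)) ?_
    refine tendsto_const_nhds.congr fun n => ?_
    exact ((u n).causal_op s f hf t ht).symm
  have h2 : IsHilbertSchmidt F := isHilbertSchmidt_of_memℓp (by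
    simp only [hcol]; exact lp.memℓp g)
  refine ⟨mk F h1 h2, ?_⟩
  rw [hc.isEmbedding.tendsto_nhds_iff]
  have : columns T (mk F h1 h2) = g := lp.ext (funext hcol)
  rw [this]
  exact hg

end HardyTwo

/-- The space `𝒞₂ = 𝒞 ∩ 𝐇₂(𝒯)` of Hilbert–Schmidt constants, with the Hilbert–Schmidt norm. -/
noncomputable def constTwo : Submodule ℂ T.HardyTwo where
  carrier := {F | T.IsConst (HardyTwo.op T F)}
  zero_mem' := by
    refine ⟨fun _ _ _ _ _ => rfl, ?_⟩
    simp only [map_zero, star_zero]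
    exact fun _ _ _ _ _ => rfl
  add_mem' := by
    rintro F G ⟨h1, h2⟩ ⟨h3, h4⟩
    refine ⟨(F + G).causal_op, fun s f hf t ht => ?_⟩
    simp [h2 s f hf t ht, h4 s f hf t ht]
  smul_mem' := by
    rintro c F ⟨h1, h2⟩
    refine ⟨(c • F).causal_op, fun s f hf t ht => ?_⟩
    simp [h2 s f hf t ht]

/-- An element of `𝒞₂` as an operator. -/
noncomputable def constOp (d : T.constTwo) : Op V := HardyTwo.op T d

/-! ### Schur multipliers and de Branges–Rovnyak spaces -/

/-- A Schur multiplier: a causal operator `S` with `‖S‖ ≤ 1`. -/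
structure SchurMultiplier where
  op : Op V
  causal : T.Causal op
  norm_le_one : ‖op‖ ≤ 1

theorem isHilbertSchmidt_mul {V : Type*} (S : Op V) {F : Op V} (hF : IsHilbertSchmidt F) :
    IsHilbertSchmidt (S * F) := by
  refine Summable.of_nonneg_of_le (fun t => by positivity) (fun t => ?_)
    (Summable.mul_left (‖S‖ ^ 2) hF)
  rw [← mul_pow]
  gcongr
  exact S.le_opNorm _

namespace SchurMultiplier

variable {T} (S : T.SchurMultiplier)

/-- The multiplication operator `M_S F = S F` on `𝐇₂(𝒯)`. -/
noncomputable def mulLeft : T.HardyTwo →L[ℂ] T.HardyTwo :=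
  LinearMap.mkContinuous
    { toFun := fun F => HardyTwo.mk (S.op * HardyTwo.op T F)
        (fun s f hf => S.causal s _ (F.causal_op s f hf))
        (isHilbertSchmidt_mul S.op F.isHilbertSchmidt_op)
      map_add' := fun F G => HardyTwo.op_injective (mul_add S.op F.1 G.1)
      map_smul' := fun c F => HardyTwo.op_injective (mul_smul_comm c S.op F.1) } 1
    (fun F => by
      refine lp.norm_le_of_forall_sum_le (by simp) (by positivity) fun s => ?_
      have h := lp.sum_rpow_le_norm_rpow (p := 2) (by simp) (HardyTwo.columns T F) s
      have e : ∀ t, ‖(S.op * HardyTwo.op T F) (chi t)‖ ≤ ‖HardyTwo.op T F (chi t)‖ := fun t =>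
        (S.op.le_opNorm _).trans (mul_le_of_le_one_left (norm_nonneg _) S.norm_le_one)
      rw [one_mul]
      refine le_trans (Finset.sum_le_sum fun t _ => ?_) h
      exact Real.rpow_le_rpow (norm_nonneg _) (e t) (by simp))

theorem op_mulLeft (F : T.HardyTwo) : HardyTwo.op T (S.mulLeft F) = S.op * HardyTwo.op T F := rfl

/-- The operator `𝓑_S = I - M_S M_S*` on `𝐇₂(𝒯)`. -/
noncomputable def defect : T.HardyTwo →L[ℂ] T.HardyTwo :=
  1 - S.mulLeft * star S.mulLeft

theorem norm_mulLeft_le : ‖S.mulLeft‖ ≤ 1 := LinearMap.mkContinuous_norm_le _ zero_le_one _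

theorem defect_nonneg : 0 ≤ S.defect := by
  refine sub_nonneg.2 ((CStarAlgebra.norm_le_one_iff_of_nonneg _ (mul_star_self_nonneg _)).1 ?_)
  rw [CStarRing.norm_self_mul_star]
  exact mul_le_one₀ S.norm_mulLeft_le (norm_nonneg _) S.norm_mulLeft_le

/-- The positive square root of `𝓑_S`. -/
noncomputable def sqrtDefect : T.HardyTwo →L[ℂ] T.HardyTwo := CFC.sqrt S.defect

/-- The orthogonal projection `π_S` of `𝐇₂(𝒯)` onto the kernel of `𝓑_S`. -/
noncomputable def projKer : T.HardyTwo →L[ℂ] T.HardyTwo := S.defect.ker.starProjection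

theorem sqrtDefect_eq_zero_iff (F : T.HardyTwo) : S.sqrtDefect F = 0 ↔ S.defect F = 0 := by
  have h1 : S.sqrtDefect * S.sqrtDefect = S.defect := CFC.sqrt_mul_sqrt_self _ S.defect_nonneg
  have h2 : S.defect F = S.sqrtDefect (S.sqrtDefect F) := by rw [← h1]; rfl
  refine ⟨fun h => by rw [h2, h, map_zero], fun h => ?_⟩
  have h3 : IsSelfAdjoint S.sqrtDefect := (CFC.sqrt_nonneg S.defect).isSelfAdjoint
  have h4 := ContinuousLinearMap.adjoint_inner_right S.sqrtDefect F (S.sqrtDefect F)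
  rw [← ContinuousLinearMap.star_eq_adjoint, h3.star_eq, ← h2, h, inner_zero_right] at h4
  exact inner_self_eq_zero.1 h4.symm

theorem sqrtDefect_eq_iff (F G : T.HardyTwo) :
    S.sqrtDefect F = S.sqrtDefect G ↔ F - S.projKer F = G - S.projKer G := by
  rw [← sub_eq_zero, ← map_sub, sqrtDefect_eq_zero_iff]
  have h : S.defect (F - G) = 0 ↔ S.projKer (F - G) = F - G := by
    rw [projKer, Submodule.starProjection_eq_self_iff]
    rfl
  rw [h, map_sub]
  constructor
  · intro h
    rw [sub_eq_sub_iff_sub_eq_sub, ← h]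
  · intro h
    rw [sub_eq_sub_iff_sub_eq_sub] at h
    exact h.symm

/-- The set `√𝓑_S 𝐇₂(𝒯)`. -/
noncomputable def rangeSqrt : Submodule ℂ T.HardyTwo := S.sqrtDefect.range

/-- The map `√𝓑_S F ↦ (I - π_S) F`. -/
noncomputable def lift : S.rangeSqrt →ₗ[ℂ] T.HardyTwo where
  toFun y := Classical.choose y.2 - S.projKer (Classical.choose y.2)
  map_add' x y := by
    rw [← add_sub_add_comm, ← map_add, ← sqrtDefect_eq_iff, map_add]
    exact (Classical.choose_spec (x + y).2).trans (congrArg₂ (· + ·)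
      (Classical.choose_spec x.2).symm (Classical.choose_spec y.2).symm)
  map_smul' c x := by
    rw [RingHom.id_apply, smul_sub, ← map_smul, ← sqrtDefect_eq_iff, map_smul]
    exact (Classical.choose_spec (c • x).2).trans
      (congrArg (c • ·) (Classical.choose_spec x.2).symm)

theorem lift_apply (F : T.HardyTwo) :
    S.lift ⟨S.sqrtDefect F, ⟨F, rfl⟩⟩ = F - S.projKer F :=
  (S.sqrtDefect_eq_iff _ _).1 (Classical.choose_spec
    (show S.sqrtDefect F ∈ S.sqrtDefect.range from ⟨F, rfl⟩))

theorem lift_injective : Function.Injective S.lift := by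
  rintro ⟨_, F, rfl⟩ ⟨_, G, rfl⟩ h
  have h' := (S.lift_apply F).symm.trans (h.trans (S.lift_apply G))
  exact Subtype.ext ((S.sqrtDefect_eq_iff F G).2 h')

/-- The de Branges–Rovnyak space `𝐇(S) = √𝓑_S 𝐇₂(𝒯)`, with the norm
`‖√𝓑_S F‖ = ‖(I - π_S) F‖₂`. -/
def DeBrangesRovnyak : Type _ := S.rangeSqrt

namespace DeBrangesRovnyak

/-- The norm `‖√𝓑_S F‖ = ‖(I - π_S) F‖₂`. -/
noncomputable instance : NormedAddCommGroup S.DeBrangesRovnyak :=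
  NormedAddCommGroup.induced S.rangeSqrt T.HardyTwo S.lift S.lift_injective

noncomputable instance : InnerProductSpace ℂ S.DeBrangesRovnyak :=
  InnerProductSpace.induced (G := S.rangeSqrt) S.lift

/-- The inclusion of `𝐇(S)` into `𝐇₂(𝒯)`. -/
noncomputable def incl : S.DeBrangesRovnyak →ₗ[ℂ] T.HardyTwo where
  toFun F := F.1
  map_add' _ _ := rfl
  map_smul' _ _ := rfl

/-- An element of `𝐇(S)` as an operator. -/
noncomputable def op {S : T.SchurMultiplier} (F : S.DeBrangesRovnyak) : Op V :=
  HardyTwo.op T (incl S F)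

/-- The element `√𝓑_S F` of `𝐇(S)`. -/
noncomputable def ofSqrt (F : T.HardyTwo) : S.DeBrangesRovnyak := ⟨S.sqrtDefect F, ⟨F, rfl⟩⟩

theorem norm_eq (x : S.rangeSqrt) : ‖(show S.DeBrangesRovnyak from x)‖ = ‖S.lift x‖ := rfl

theorem norm_ofSqrt (F : T.HardyTwo) : ‖ofSqrt S F‖ = ‖F - S.projKer F‖ := by
  rw [← S.lift_apply F]
  exact norm_eq S _

end DeBrangesRovnyak

end SchurMultiplier

end MultiscaleTree

end Multiscale

open Multiscale

/-! Write `M` for multiplication by `S` on the left of the Hardy space and `N` for multiplication by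
`α_j*` on the right. The level of a node is constant on horocycles and grows away from the boundary
point. Causal operators are exactly those whose matrix is triangular with respect to the level, and
constants are the block diagonal ones. Comparing entries shows that `N*` is the backward shift `F ↦
(F - F_[∅]) α_j`, that `N` is a partial isometry, and that `E = 1 - N N*` is the projection onto the
constants, the same for every `j`. Moreover `M` commutes with `N` and with `N* N`.

These relations give two things. The first is the estimate `‖√𝓑 N z‖² + ‖E M* N z‖² ≤ ‖√𝓑 z‖²`
(`shift_defect_add_le`), where `‖√𝓑 z‖² = ‖z‖² - ‖M* z‖²`. By duality its two summands bound the
inner products of `A_j F` and `B_j d` with `z`, and a range criterion of Douglas type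
(`exists_preimage_of_inner_le`) places both in the de Branges–Rovnyak space and shows that `A_j` and
`B_j` are contractions. The second is the pair of identities `N* M = M N* + N* M E` and `E M E = E
M`.

Let `Z_w` be the iterated backward shift along `w`. Its constant part is `E Z_w F = ∑_{|v| = |w|} v*
F_[v] w` (`op_constProj_backwardShift`), so the `U_w` of the theorem is `E Z_w U`. The first
identity yields by induction `X_w = Z_w Y - S Z_w U` (`incl_state_eq`), and the second then yields
`C X_v + D U_v = E Z_v Y`. Multiplying by `w` on the left and by `v*` on the right isolates `Y_[w]`,
because words of equal length satisfy `w w'* = δ`. -/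

namespace Multiscale

/-! ### Levels, horocycles and predecessors -/

namespace PointedTree

variable {q : ℕ} {V : Type*} (T : PointedTree q V)

theorem steps_ray_left (s : V) (n : ℕ) : T.steps ((T.ray s).node n) s = 0 :=
  Nat.le_zero.1 (Nat.sInf_le ⟨n, fun k => by rw [T.ray_node, Nat.zero_add]⟩)

theorem steps_ray_right (s : V) (n : ℕ) : T.steps s ((T.ray s).node n) = n := by
  have h := T.dist_ray s n
  rw [dist, steps_ray_left] at h
  simpa using h

/-- The level of a node, constant on horocycles and increasing away from the boundary point. -/
noncomputable def lev (s : V) : ℤ :=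
  (T.steps s (Classical.choice T.isTree.connected.nonempty) : ℤ) -
    T.steps (Classical.choice T.isTree.connected.nonempty) s

/-- Passing from the ray of `s` to that of `o` through the ray of `t` gives a second coincidence
besides the minimal one, and any two coincidences of the same rays have the same offset
(`coincide_add`). Hence the signed offset is additive and does not depend on the base node. -/
theorem lev_sub_lev (s t : V) : T.lev s - T.lev t = (T.steps s t : ℤ) - T.steps t s := by
  unfold lev
  set o : V := Classical.choice T.isTree.connected.nonempty
  have h1 := T.coincide_steps s o
  have h2 := T.coincide_steps t o
  have h3 := T.coincide_steps s t
  have h4 : (T.ray o).Coincide (T.ray s) (T.steps o t + T.steps t s)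
      (T.steps s t + T.steps t o) := fun k => by
    have e1 := h2 (T.steps t s + k)
    have e2 := h3 (T.steps t o + k)
    rw [add_assoc, e1, add_assoc, ← e2]
    congr 1
    omega
  have := T.coincide_add h1 h4
  omega

theorem le_iff_lev (s t : V) : T.le s t ↔ T.lev s ≤ T.lev t := by
  have := T.lev_sub_lev s t
  rw [le_iff]
  omega

theorem horo_iff_lev (s t : V) : T.horo s t ↔ T.lev s = T.lev t := by
  have := T.lev_sub_lev s t
  rw [horo_iff]
  omega

/-- The predecessor of a node on the way to the boundary point. -/
noncomputable def parent (t : V) : V := (T.ray t).node 1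

theorem lev_parent (t : V) : T.lev (T.parent t) = T.lev t - 1 := by
  have := T.lev_sub_lev t (T.parent t)
  rw [parent, steps_ray_left, steps_ray_right] at this
  rw [parent]
  push_cast at this
  omega

theorem le_parent (t : V) : T.le (T.parent t) t ∧ T.dist (T.parent t) t = 1 := by
  refine ⟨by rw [le_iff_lev, lev_parent]; omega, ?_⟩
  rw [dist, parent, steps_ray_left, steps_ray_right]

/-- If `u` is not the second node of the ray from `v`, then prefixing `u` to that ray does not
backtrack, so by uniqueness of representatives the result is the ray from `u`. -/
theorem eq_parent_or_parent_eq {u v : V} (h : T.graph.Adj u v) :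
    u = T.parent v ∨ T.parent u = v := by
  refine or_iff_not_imp_left.2 fun hu => ?_
  have h0 := T.ray_zero v
  let r : Ray T.graph :=
    { node := fun k => Nat.casesOn k u (T.ray v).node
      adj := by
        rintro (_ | k)
        · simpa [h0] using h
        · exact (T.ray v).adj k
      ne := by
        rintro (_ | k)
        · exact hu
        · exact (T.ray v).ne k }
  have hr : (T.ray u).toBoundary = r.toBoundary := by
    rw [ray_toBoundary, ← T.ray_toBoundary v, Ray.toBoundary_eq]
    exact ⟨0, 1, fun k => by simp only [r, Nat.add_comm 1 k, Nat.zero_add]⟩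
  have := congrFun (Ray.eq_of_origin T.isTree hr (T.ray_zero u)) 1
  rw [parent, this]
  exact h0

end PointedTree

/-! ### Primitive shifts and the action of words on nodes -/

namespace MultiscaleTree

variable {q : ℕ} {V : Type*} (T : MultiscaleTree q V)

theorem parent_shift (j : Fin q) (t : V) : T.parent (T.shift j t) = t := by
  have : T.shift j t ∈ Set.range (fun j => T.shift j t) := ⟨j, rfl⟩
  rw [T.range_shift t] at this
  exact T.ray_one_of_le this.1 this.2

theorem exists_shift_parent (t : V) : ∃ j, T.shift j (T.parent t) = t := by
  have : t ∈ Set.range (fun j => T.shift j (T.parent t)) := by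
    rw [T.range_shift]
    exact T.le_parent t
  exact this

theorem lev_shift (j : Fin q) (t : V) : T.lev (T.shift j t) = T.lev t + 1 := by
  have := T.lev_parent (T.shift j t)
  rw [parent_shift] at this
  omega

/-- Counting: the `q + 1` neighbours of `t` lie among its predecessor and the nodes `t α_j`, so the
latter must be `q` distinct nodes. This is where the order of the tree enters. -/
theorem shift_index_injective (t : V) : Function.Injective fun j => T.shift j t := by
  have h1 : T.graph.neighborSet t ⊆ insert (T.parent t) (Set.range fun j => T.shift j t) := by
    intro u hu
    rcases T.eq_parent_or_parent_eq (SimpleGraph.Adj.symm hu) with h | h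
    · exact Or.inl h
    · obtain ⟨j, hj⟩ := T.exists_shift_parent u
      exact Or.inr ⟨j, by rw [← h]; exact hj⟩
  have h2 := Set.encard_le_encard h1
  rw [T.encard_neighborSet] at h2
  have h3 := h2.trans (Set.encard_insert_le _ _)
  classical
  have h4 : Set.range (fun j => T.shift j t) =
      ((Finset.univ.image fun j => T.shift j t : Finset V) : Set V) := by simp
  rw [h4, Set.encard_coe_eq_coe_finsetCard] at h3
  have h5 : q ≤ (Finset.univ.image fun j => T.shift j t).card := by
    have : q + 1 ≤ (Finset.univ.image fun j => T.shift j t).card + 1 := by exact_mod_cast h3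
    omega
  have h6 : (Finset.univ.image fun j => T.shift j t).card = (Finset.univ : Finset (Fin q)).card :=
    le_antisymm Finset.card_image_le (by simpa using h5)
  have h7 := Finset.card_image_iff.1 h6
  exact fun a b h => h7 (by simp) (by simp) h

theorem shift_eq_shift_iff {i j : Fin q} {s t : V} :
    T.shift i s = T.shift j t ↔ i = j ∧ s = t := by
  refine ⟨fun h => ?_, fun ⟨h1, h2⟩ => by rw [h1, h2]⟩
  have hst : s = t := by rw [← T.parent_shift i s, h, parent_shift]
  subst hst
  exact ⟨T.shift_index_injective s h, rfl⟩

/-- The right action `t ↦ t w` of a word on the nodes. -/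
def act (w : List (Fin q)) (t : V) : V := w.foldl (fun s j => T.shift j s) t

@[simp] theorem act_nil (t : V) : T.act [] t = t := rfl

@[simp] theorem act_cons (j : Fin q) (w : List (Fin q)) (t : V) :
    T.act (j :: w) t = T.act w (T.shift j t) := rfl

theorem act_append_singleton (w : List (Fin q)) (j : Fin q) (t : V) :
    T.act (w ++ [j]) t = T.shift j (T.act w t) := by
  simp [act]

theorem lev_act (w : List (Fin q)) (t : V) : T.lev (T.act w t) = T.lev t + w.length := by
  induction w generalizing t with
  | nil => simp
  | cons j w ih => rw [act_cons, ih, lev_shift, List.length_cons]; push_cast; ring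

/-- A node determines its predecessor and the index of the shift leading to it, hence its `n`-th
ancestor and the word of length `n` leading back. This is the source of the relations `w w'* = δ`
for words of equal length. -/
theorem act_eq_act {w v : List (Fin q)} (h : w.length = v.length) {s t : V}
    (e : T.act w s = T.act v t) : w = v ∧ s = t := by
  induction w generalizing v s t with
  | nil =>
    obtain rfl := List.length_eq_zero_iff.1 h.symm
    exact ⟨rfl, e⟩
  | cons j w ih =>
    cases v with
    | nil => simp at h
    | cons i v =>
      obtain ⟨h1, h2⟩ := ih (v := v) (s := T.shift j s) (t := T.shift i t) (by simpa using h) e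
      obtain ⟨h3, h4⟩ := T.shift_eq_shift_iff.1 h2
      exact ⟨by rw [h1, h3], h4⟩

theorem act_injective (w : List (Fin q)) : Function.Injective (T.act w) :=
  fun _ _ h => (T.act_eq_act rfl h).2

theorem exists_act (n : ℕ) (t : V) :
    ∃ (w : List (Fin q)) (s : V), w.length = n ∧ T.act w s = t := by
  induction n generalizing t with
  | zero => exact ⟨[], t, rfl, rfl⟩
  | succ n ih =>
    obtain ⟨j, hj⟩ := T.exists_shift_parent t
    obtain ⟨w, s, hw, hs⟩ := ih (T.parent t)
    exact ⟨w ++ [j], s, by simp [hw], by rw [act_append_singleton, hs, hj]⟩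

end MultiscaleTree

local notation "⟪" x ", " y "⟫" => inner ℂ x y

/-! ### Hilbert space estimates and identities for a contraction and a partial isometry -/

section Hilbert

variable {H : Type*} [NormedAddCommGroup H] [InnerProductSpace ℂ H] [CompleteSpace H]

theorem inner_star_left (K : H →L[ℂ] H) (x y : H) : ⟪star K x, y⟫ = ⟪x, K y⟫ :=
  ContinuousLinearMap.adjoint_inner_left K y x

theorem inner_star_right (K : H →L[ℂ] H) (x y : H) : ⟪x, star K y⟫ = ⟪K x, y⟫ :=
  ContinuousLinearMap.adjoint_inner_right K x y

/-- A vector whose inner products are dominated by a selfadjoint operator is in its range. -/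
theorem exists_preimage_of_inner_le {D : H →L[ℂ] H} (hD : star D = D) {y : H} {c : ℝ}
    (hc : 0 ≤ c) (h : ∀ z, ‖⟪y, z⟫‖ ≤ c * ‖D z‖) : ∃ x, D x = y ∧ ‖x‖ ≤ c := by
  have hk : D.toLinearMap.ker ≤ (innerSL ℂ y).toLinearMap.ker := by
    intro z hz
    have hz' : D z = 0 := hz
    have := h z
    rw [hz', norm_zero, mul_zero] at this
    exact norm_le_zero_iff.1 this
  -- The functional `D z ↦ ⟪y, z⟫` on the range of `D` is well defined since `ker D` annihilates
  -- `y`, and it is bounded by `c`. A norm preserving extension is represented by the required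
  -- preimage.
  let f : D.toLinearMap.range →ₗ[ℂ] ℂ :=
    (D.toLinearMap.ker.liftQ (innerSL ℂ y).toLinearMap hk) ∘ₗ
      D.toLinearMap.quotKerEquivRange.symm.toLinearMap
  have hf : ∀ z, f ⟨D z, z, rfl⟩ = ⟪y, z⟫ := by
    intro z
    have : D.toLinearMap.quotKerEquivRange.symm ⟨D z, z, rfl⟩ = Submodule.Quotient.mk z := by
      rw [LinearEquiv.symm_apply_eq]
      rfl
    simp only [f, LinearMap.comp_apply, LinearEquiv.coe_coe, this]
    rfl
  let F : StrongDual ℂ D.toLinearMap.range := f.mkContinuous c (by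
    rintro ⟨_, z, rfl⟩
    exact (congrArg norm (hf z)).trans_le (h z))
  have hF : ‖F‖ ≤ c := LinearMap.mkContinuous_norm_le _ hc _
  obtain ⟨g, hg, hgn⟩ := exists_extension_norm_eq D.toLinearMap.range F
  refine ⟨(InnerProductSpace.toDual ℂ H).symm g, ?_, by
    rw [LinearIsometryEquiv.norm_map, hgn]; exact hF⟩
  refine ext_inner_right ℂ fun z => ?_
  rw [← hD, inner_star_left, InnerProductSpace.toDual_symm_apply]
  exact (hg ⟨D z, z, rfl⟩).trans (hf z)

/-- Pythagoras for the splitting of `M* N z` along the range of `N` and its complement: the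
commutation relations turn the component `N N* M* N z` into `N M* z`. -/
theorem norm_sq_star_mul_eq {M N : H →L[ℂ] H} (hc : M * N = N * M)
    (hQ : star N * N * M = M * (star N * N)) (hN : N * star N * N = N) (z : H) :
    ‖star M (N z)‖ ^ 2 =
      ‖N (star M z)‖ ^ 2 + ‖(1 - N * star N) (star M (N z))‖ ^ 2 := by
  have hQ' : star M * (star N * N) = star N * N * star M := by
    simpa only [star_mul, star_star] using congrArg star hQ
  have hc' : star N * star M = star M * star N := by
    simpa only [star_mul] using congrArg star hc
  have e1 : N * star N * (star M * N) = N * star M := by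
    calc N * star N * (star M * N) = N * (star N * star M) * N := by simp only [mul_assoc]
      _ = N * (star M * (star N * N)) := by rw [hc']; simp only [mul_assoc]
      _ = N * star N * N * star M := by rw [hQ']; simp only [mul_assoc]
      _ = N * star M := by rw [hN]
  have e2 : star M (N z) = N (star M z) + (1 - N * star N) (star M (N z)) := by
    have := congrArg (fun K : H →L[ℂ] H => K z) e1
    simp only [mul_apply_eq_comp] at this
    rw [sub_apply, one_apply_eq_self, mul_apply_eq_comp, this]
    abel
  have e3 : star N * (1 - N * star N) = 0 := by
    have := congrArg star hN
    simp only [star_mul, star_star] at this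
    rw [mul_sub, mul_one, this, sub_self]
  have e4 : ⟪N (star M z), (1 - N * star N) (star M (N z))⟫ = 0 := by
    rw [← inner_star_right, ← mul_apply_eq_comp, e3, zero_apply, inner_zero_right]
  have := norm_add_sq_eq_norm_sq_add_norm_sq_of_inner_eq_zero _ _ e4
  rw [← e2] at this
  simpa only [sq] using this

/-- Since `M*` commutes with the projection `N* N`, the quadratic form `‖z‖² - ‖M* z‖²` splits into
its parts on the initial space of `N` and on the kernel of `N`. The second part is nonnegative
because `M` is a contraction. -/
theorem norm_sq_sub_le {M N : H →L[ℂ] H} (hM : ‖M‖ ≤ 1)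
    (hQ : star N * N * M = M * (star N * N)) (hN : N * star N * N = N) (z : H) :
    ‖N z‖ ^ 2 - ‖N (star M z)‖ ^ 2 ≤ ‖z‖ ^ 2 - ‖star M z‖ ^ 2 := by
  have hQ' : star M * (star N * N) = star N * N * star M := by
    simpa only [star_mul, star_star] using congrArg star hQ
  have key : ∀ x, ‖x‖ ^ 2 = ‖x - star N (N x)‖ ^ 2 + ‖N x‖ ^ 2 := by
    intro x
    have e0 : N (star N (N x)) = N x := congrArg (fun K : H →L[ℂ] H => K x) hN
    have e1 : ⟪x - star N (N x), star N (N x)⟫ = 0 := by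
      rw [inner_star_right, map_sub, e0, sub_self, inner_zero_left]
    have e2 : ‖star N (N x)‖ ^ 2 = ‖N x‖ ^ 2 := by
      have : ⟪star N (N x), star N (N x)⟫ = ⟪N x, N x⟫ := by rw [inner_star_left, e0]
      rw [inner_self_eq_norm_sq_to_K, inner_self_eq_norm_sq_to_K] at this
      exact_mod_cast this
    have := norm_add_sq_eq_norm_sq_add_norm_sq_of_inner_eq_zero _ _ e1
    rw [sub_add_cancel] at this
    nlinarith
  have h1 := key z
  have h2 := key (star M z)
  have h3 : star M z - star N (N (star M z)) = star M (z - star N (N z)) := by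
    rw [map_sub]
    exact congrArg (fun K : H →L[ℂ] H => star M z - K z) hQ'.symm
  have h4 : ‖star M (z - star N (N z))‖ ≤ ‖z - star N (N z)‖ := by
    refine (ContinuousLinearMap.le_opNorm _ _).trans (mul_le_of_le_one_left (norm_nonneg _) ?_)
    rwa [norm_star]
  rw [h3] at h2
  have h5 := pow_le_pow_left₀ (norm_nonneg _) h4 2
  linarith

/-- The estimate behind the coisometric backward shift realization. -/
theorem shift_defect_add_le {M N : H →L[ℂ] H} (hM : ‖M‖ ≤ 1) (hc : M * N = N * M)
    (hQ : star N * N * M = M * (star N * N)) (hN : N * star N * N = N) (z : H) :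
    ‖N z‖ ^ 2 - ‖star M (N z)‖ ^ 2 + ‖(1 - N * star N) (star M (N z))‖ ^ 2 ≤
      ‖z‖ ^ 2 - ‖star M z‖ ^ 2 := by
  have h1 := norm_sq_star_mul_eq hc hQ hN z
  have h2 := norm_sq_sub_le hM hQ hN z
  linarith

/-- On the range of `N` the operator `M` commutes with the backward shift `N*`; the defect comes
only from the projection `1 - N N*`. This drives the induction for the states. -/
theorem star_mul_eq_add {M N : H →L[ℂ] H} (hc : M * N = N * M)
    (hQ : star N * N * M = M * (star N * N)) (hN : N * star N * N = N) :
    star N * M = M * star N + star N * M * (1 - N * star N) := by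
  have hN' : star N * N * star N = star N := by
    simpa only [star_mul, star_star, ← mul_assoc] using congrArg star hN
  have : star N * M * (N * star N) = M * star N := by
    calc star N * M * (N * star N) = star N * (M * N) * star N := by simp only [mul_assoc]
      _ = star N * N * M * star N := by rw [hc]; simp only [mul_assoc]
      _ = M * (star N * N * star N) := by rw [hQ]; simp only [mul_assoc]
      _ = M * star N := by rw [hN']
  rw [mul_sub, mul_one, this]
  abel

/-- `M` leaves the range of `N` invariant, and `1 - N N*` vanishes there. -/
theorem one_sub_mul_mul_self {M N : H →L[ℂ] H} (hc : M * N = N * M) (hN : N * star N * N = N) :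
    (1 - N * star N) * M * (1 - N * star N) = (1 - N * star N) * M := by
  have : (1 - N * star N) * M * (N * star N) = 0 := by
    calc (1 - N * star N) * M * (N * star N)
        = (1 - N * star N) * (M * N) * star N := by simp only [mul_assoc]
      _ = ((1 - N * star N) * N) * (M * star N) := by rw [hc]; simp only [mul_assoc]
      _ = 0 := by rw [sub_mul, one_mul, hN, sub_self, zero_mul]
  rw [mul_sub, mul_one, this, sub_zero]

end Hilbert

open MultiscaleTree

/-! ### Matrix entries of operators on `ℓ₂` -/

section Basis

variable {V : Type*}

theorem chi_self (t : V) : chi t t = 1 := by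
  classical
  simp [chi]

theorem chi_of_ne {s t : V} (h : s ≠ t) : chi t s = 0 := by
  classical
  simp [chi, h]

theorem inner_chi_left (t : V) (f : L2 V) : ⟪chi t, f⟫ = f t := by
  classical
  rw [chi, lp.inner_single_left]
  simp

theorem star_apply_apply (F : Op V) (f : L2 V) (t : V) : star F f t = ⟪F (chi t), f⟫ := by
  rw [← inner_chi_left, inner_star_right]

theorem star_chi_apply (F : Op V) (s t : V) :
    star F (chi s) t = star (F (chi t) s) := by
  rw [star_apply_apply, ← inner_conj_symm, inner_chi_left]
  rfl

/-- The matrix of an operator acts by summation. -/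
theorem hasSum_apply (F : Op V) (f : L2 V) (t : V) :
    HasSum (fun r => f r * F (chi r) t) (F f t) := by
  have h := ((hasSum_chi f).mapL F).mapL (lp.evalCLM ℂ (fun _ : V => ℂ) 2 t)
  simp only [map_smul] at h
  exact h

theorem op_ext_entry {F G : Op V} (h : ∀ t r, F (chi t) r = G (chi t) r) : F = G :=
  op_ext fun t => lp.ext (funext (h t))

theorem proj_chi_of_mem {A : Set V} {t : V} (h : t ∈ A) : proj A (chi t) = chi t := by
  refine lp.ext (funext fun r => ?_)
  rw [proj_apply]
  by_cases hr : r ∈ A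
  · rw [Set.indicator_of_mem hr]
  · rw [Set.indicator_of_notMem hr, chi_of_ne]
    rintro rfl
    exact hr h

theorem proj_chi_of_notMem {A : Set V} {t : V} (h : t ∉ A) : proj A (chi t) = 0 := by
  refine lp.ext (funext fun r => ?_)
  rw [proj_apply]
  by_cases hr : r ∈ A
  · rw [Set.indicator_of_mem hr, chi_of_ne]
    · rfl
    · rintro rfl
      exact h hr
  · rw [Set.indicator_of_notMem hr]
    rfl

theorem norm_opOfBound_le (Φ : L2 V →ₗ[ℂ] (V → ℂ)) (C : ℝ) (hC : 0 ≤ C)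
    (h : ∀ f (s : Finset V), ∑ t ∈ s, ‖Φ f t‖ ^ 2 ≤ (C * ‖f‖) ^ 2) :
    ‖opOfBound Φ C hC h‖ ≤ C := by
  unfold opOfBound
  exact LinearMap.mkContinuous_norm_le _ hC _

theorem norm_proj_le (A : Set V) (f : L2 V) : ‖proj A f‖ ≤ ‖f‖ := by
  have h : ‖proj A‖ ≤ 1 := norm_opOfBound_le _ _ _ _
  exact ((proj A).le_opNorm f).trans (mul_le_of_le_one_left (norm_nonneg _) h)

end Basis

namespace MultiscaleTree

variable {q : ℕ} {V : Type*} (T : MultiscaleTree q V)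

/-! ### Words -/

theorem alpha_apply (j : Fin q) (f : L2 V) (t : V) : T.alpha j f t = f (T.shift j t) := rfl

@[simp] theorem word_nil : T.word [] = 1 := rfl

theorem word_cons (j : Fin q) (w : List (Fin q)) : T.word (j :: w) = T.alpha j * T.word w := by
  simp [word]

theorem word_apply (w : List (Fin q)) (f : L2 V) (t : V) : T.word w f t = f (T.act w t) := by
  induction w generalizing t with
  | nil => rfl
  | cons j w ih =>
    rw [word_cons, mul_apply_eq_comp, alpha_apply, ih, act_cons]

theorem word_chi_act (w : List (Fin q)) (t : V) : T.word w (chi (T.act w t)) = chi t := by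
  refine lp.ext (funext fun r => ?_)
  rw [word_apply]
  by_cases h : r = t
  · rw [h, chi_self, chi_self]
  · rw [chi_of_ne h, chi_of_ne fun e => h (T.act_injective w e)]

theorem word_chi_of_notMem {w : List (Fin q)} {t : V} (h : t ∉ Set.range (T.act w)) :
    T.word w (chi t) = 0 := by
  refine lp.ext (funext fun r => ?_)
  rw [word_apply, chi_of_ne]
  · rfl
  · exact fun e => h ⟨r, e⟩

theorem star_word_apply_act (w : List (Fin q)) (f : L2 V) (t : V) :
    star (T.word w) f (T.act w t) = f t := by
  rw [star_apply_apply, word_chi_act, inner_chi_left]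

theorem star_word_apply_of_notMem {w : List (Fin q)} (f : L2 V) {t : V}
    (h : t ∉ Set.range (T.act w)) : star (T.word w) f t = 0 := by
  rw [star_apply_apply, word_chi_of_notMem T h, inner_zero_left]

theorem star_word_chi (w : List (Fin q)) (t : V) :
    star (T.word w) (chi t) = chi (T.act w t) := by
  refine lp.ext (funext fun r => ?_)
  by_cases h : r ∈ Set.range (T.act w)
  · obtain ⟨s, rfl⟩ := h
    rw [star_word_apply_act]
    by_cases hs : s = t
    · rw [hs, chi_self, chi_self]
    · rw [chi_of_ne hs, chi_of_ne fun e => hs (T.act_injective w e)]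
  · rw [star_word_apply_of_notMem T _ h, chi_of_ne]
    rintro rfl
    exact h ⟨t, rfl⟩

theorem alpha_eq_word (j : Fin q) : T.alpha j = T.word [j] := by
  simp [word]

theorem word_mul_star_self (w : List (Fin q)) : T.word w * star (T.word w) = 1 :=
  op_ext fun t => by
    rw [mul_apply_eq_comp, star_word_chi, word_chi_act, one_apply_eq_self]

theorem word_mul_star_of_ne {w v : List (Fin q)} (h : w.length = v.length) (hne : w ≠ v) :
    T.word w * star (T.word v) = 0 :=
  op_ext fun t => by
    rw [mul_apply_eq_comp, star_word_chi, word_chi_of_notMem, zero_apply]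
    rintro ⟨s, hs⟩
    exact hne (T.act_eq_act h hs).1

/-! ### Causal operators and constants in terms of matrix entries -/

/-- Causality is triangularity with respect to the level. For the converse, each term of the row sum
for `F f t` vanishes, either through `f` at levels up to that of `s` or through the matrix entry
above it. -/
theorem causal_iff {F : Op V} :
    T.Causal F ↔ ∀ t r, T.lev r < T.lev t → F (chi t) r = 0 := by
  constructor
  · intro h t r hr
    refine h r (chi t) (fun s hs => chi_of_ne ?_) r ((T.le_iff_lev r r).2 le_rfl)
    rintro rfl
    rw [T.le_iff_lev] at hs
    omega
  · intro h s f hf t ht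
    rw [T.le_iff_lev] at ht
    have h0 : ∀ r, f r * F (chi r) t = 0 := by
      intro r
      by_cases hr : T.lev r ≤ T.lev s
      · rw [hf r ((T.le_iff_lev r s).2 hr), zero_mul]
      · rw [h r t (by omega), mul_zero]
    have := hasSum_apply F f t
    simp only [h0] at this
    exact this.unique hasSum_zero

theorem isConst_iff {F : Op V} :
    T.IsConst F ↔ ∀ t r, T.lev r ≠ T.lev t → F (chi t) r = 0 := by
  rw [IsConst, causal_iff, causal_iff]
  constructor
  · rintro ⟨h1, h2⟩ t r h
    rcases lt_or_gt_of_ne h with h | h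
    · exact h1 t r h
    · have := h2 r t h
      rwa [star_chi_apply, star_eq_zero] at this
  · intro h
    refine ⟨fun t r hr => h t r hr.ne, fun t r hr => ?_⟩
    rw [star_chi_apply, h r t hr.ne', star_zero]

theorem constPart_apply (F : Op V) (f : L2 V) (t : V) :
    T.constPart F f t = F (proj {r | T.horo r t} f) t := rfl

theorem constPart_chi_of_eq (F : Op V) {t r : V} (h : T.lev r = T.lev t) :
    T.constPart F (chi t) r = F (chi t) r := by
  rw [constPart_apply, proj_chi_of_mem]
  exact (T.horo_iff_lev t r).2 h.symm

theorem constPart_chi_of_ne (F : Op V) {t r : V} (h : T.lev r ≠ T.lev t) :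
    T.constPart F (chi t) r = 0 := by
  rw [constPart_apply, proj_chi_of_notMem, map_zero]
  · rfl
  · exact fun e => h ((T.horo_iff_lev t r).1 e).symm

theorem isConst_constPart (F : Op V) : T.IsConst (T.constPart F) :=
  T.isConst_iff.2 fun _ _ h => T.constPart_chi_of_ne F h

theorem constPart_chi (F : Op V) (t : V) :
    T.constPart F (chi t) = proj {r | T.lev r = T.lev t} (F (chi t)) := by
  refine lp.ext (funext fun r => ?_)
  rw [proj_apply]
  by_cases h : T.lev r = T.lev t
  · rw [constPart_chi_of_eq T F h, Set.indicator_of_mem (show r ∈ {r | T.lev r = T.lev t} from h)]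
  · rw [constPart_chi_of_ne T F h,
      Set.indicator_of_notMem (show r ∉ {r | T.lev r = T.lev t} from h)]

theorem constPart_eq_self {F : Op V} (h : T.IsConst F) : T.constPart F = F :=
  op_ext_entry fun t r => by
    by_cases e : T.lev r = T.lev t
    · exact T.constPart_chi_of_eq F e
    · rw [T.constPart_chi_of_ne F e, T.isConst_iff.1 h t r e]

/-- A constant maps functions on a horocycle to functions on the same horocycle. -/
theorem constPart_mul_const (F : Op V) {d : Op V} (hd : T.IsConst d) :
    T.constPart (F * d) = T.constPart F * d :=
  op_ext_entry fun t r => by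
    have hp : proj {p | T.horo p r} (d (chi t)) =
        if T.lev r = T.lev t then d (chi t) else 0 := by
      refine lp.ext (funext fun p => ?_)
      rw [proj_apply]
      by_cases hpt : T.lev p = T.lev t
      · split_ifs with h
        · rw [Set.indicator_of_mem]
          exact (T.horo_iff_lev p r).2 (by omega)
        · rw [Set.indicator_of_notMem]
          · rfl
          · exact fun e => h (by have := (T.horo_iff_lev p r).1 e; omega)
      · have h0 := T.isConst_iff.1 hd t p hpt
        have : ∀ A : Set V, A.indicator (fun s => d (chi t) s) p = 0 := fun A => by
          by_cases hA : p ∈ A <;> simp [hA, h0]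
        rw [this]
        split_ifs
        · exact h0.symm
        · rfl
    rw [mul_apply_eq_comp, constPart_apply T F, hp]
    split_ifs with h
    · rw [T.constPart_chi_of_eq _ h, mul_apply_eq_comp]
    · rw [T.constPart_chi_of_ne _ h, map_zero]
      rfl

theorem causal_mul {F G : Op V} (hF : T.Causal F) (hG : T.Causal G) : T.Causal (F * G) :=
  fun s f hf => hF s _ (hG s f hf)

theorem causal_star_word (w : List (Fin q)) : T.Causal (star (T.word w)) := by
  rw [causal_iff]
  intro t r h
  rw [star_word_chi, chi_of_ne]
  rintro rfl
  rw [lev_act] at h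
  omega

theorem coeff_chi_of_eq (F : Op V) (w : List (Fin q)) {t r : V} (h : T.lev r = T.lev t) :
    T.coeff F w (chi t) r = F (chi t) (T.act w r) := by
  rw [coeff, constPart_chi_of_eq T _ h, mul_apply_eq_comp, word_apply]

theorem pointEval_zero (F : Op V) : T.pointEval F 0 = T.constPart F := by
  unfold pointEval
  rw [tsum_eq_single 0]
  · rw [pow_zero, one_mul, Fintype.sum_eq_single List.Vector.nil
      fun v hv => absurd (List.Vector.eq_nil v) hv]
    change star (T.word []) * T.constPart (T.word [] * F) = _
    rw [word_nil, star_one, one_mul, one_mul]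
  · intro n hn
    have h : ∑ j, (0 : Fin q → Op V) j * T.alpha j = 0 :=
      Finset.sum_eq_zero fun j _ => zero_mul _
    rw [h, zero_pow hn, zero_mul]

/-! ### The power series expansion -/

/-- The coefficients of an expansion are determined by the matrix of the operator. -/
theorem IsExpansion.eq_coeff {F : Op V} {a : List (Fin q) → Op V} (h : T.IsExpansion F a)
    (w : List (Fin q)) : a w = T.coeff F w :=
  op_ext_entry fun t r => by
    have hc := fun w => T.isConst_iff.1 (h.1 w)
    by_cases e : T.lev r = T.lev t
    · rw [coeff_chi_of_eq T F w e, ← (h.2 (chi t) (T.act w r)).2, tsum_eq_single w]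
      · rw [mul_apply_eq_comp, star_word_apply_act]
      · intro v hv
        rw [mul_apply_eq_comp]
        by_cases hr : T.act w r ∈ Set.range (T.act v)
        · obtain ⟨p, hp⟩ := hr
          rw [← hp, star_word_apply_act]
          -- A nonzero contribution of `v` forces `p` to the level of `t`, hence of `r`. Then `v`
          -- and `w` have equal length and lead to the same node, so they agree.
          refine hc v t p fun hpt => hv ?_
          have h1 := T.lev_act v p
          rw [hp, lev_act] at h1
          exact (T.act_eq_act (by omega) hp).1
        · exact T.star_word_apply_of_notMem _ hr
    · rw [hc w t r e]
      exact (T.constPart_chi_of_ne _ e).symm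

end MultiscaleTree

theorem hasSum_of_eq {ι α : Type*} [AddCommMonoid α] [TopologicalSpace α] {f g : ι → α} {a : α}
    (h : HasSum g a) (e : ∀ i, f i = g i) : HasSum f a := by
  rwa [funext e]

theorem sum_op_apply_apply {V ι : Type*} (s : Finset ι) (F : ι → Op V) (f : L2 V) (t : V) :
    (∑ i ∈ s, F i) f t = ∑ i ∈ s, F i f t :=
  map_sum ((lp.evalCLM ℂ (fun _ : V => ℂ) 2 t).comp (ContinuousLinearMap.apply ℂ (L2 V) f)) F s

namespace MultiscaleTree

variable {q : ℕ} {V : Type*} (T : MultiscaleTree q V)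

/-- A causal operator is the sum of its power series. -/
theorem isExpansion_coeff {F : Op V} (hF : T.Causal F) : T.IsExpansion F (T.coeff F) := by
  refine ⟨fun w => T.isConst_constPart _, fun f t => ?_⟩
  -- For each `n` exactly one word `e n` of length `n` ends at `t`, starting at the `n`-th ancestor
  -- `p n`. At the node `t` the series over all words therefore reduces to a series over `n`.
  -- Absolute convergence is automatic for unconditionally convergent series of complex numbers.
  choose e p he hp using fun n => T.exists_act n t
  have einj : Function.Injective e := fun m n h => by rw [← he m, h, he n]
  have hlev : ∀ n, T.lev (p n) = T.lev t - n := fun n => by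
    have := T.lev_act (e n) (p n)
    rw [hp, he] at this
    omega
  suffices h : HasSum (fun w => (star (T.word w) * T.coeff F w) f t) (F f t) from
    ⟨h.summable.norm, h.tsum_eq⟩
  rw [← einj.hasSum_iff]
  -- The row sum for `F f t` is regrouped by level difference: the group of index `n` collects the
  -- horocycle of `p n`.
  · have h1 := (hasSum_apply F f t).tsum_fiberwise fun r => (T.lev t - T.lev r).toNat
    refine hasSum_of_eq h1 fun n => ?_
    have h2 := hasSum_apply F (proj {r | T.horo r (p n)} f) t
    have h3 : (star (T.word (e n)) * T.coeff F (e n)) f t =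
        F (proj {r | T.horo r (p n)} f) t := by
      conv_lhs => rw [← hp n]
      rw [mul_apply_eq_comp, star_word_apply_act, coeff, constPart_apply, mul_apply_eq_comp,
        word_apply, hp]
    rw [Function.comp_apply, h3, ← h2.tsum_eq]
    refine Eq.trans (tsum_congr fun r => ?_)
      (tsum_subtype ((fun r => (T.lev t - T.lev r).toNat) ⁻¹' {n})
        fun r => f r * F (chi r) t).symm
    rw [proj_apply]
    -- Truncation by `toNat` puts all nodes of level above that of `t` into the group `n = 0`;
    -- causality makes their terms vanish.
    by_cases hr : T.lev t < T.lev r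
    · rw [(T.causal_iff.1 hF) r t hr, mul_zero]
      exact (Set.indicator_apply_eq_zero.2 fun _ => by
        rw [(T.causal_iff.1 hF) r t hr, mul_zero]).symm
    · have hiff : r ∈ {r | T.horo r (p n)} ↔
          r ∈ (fun r => (T.lev t - T.lev r).toNat) ⁻¹' {n} := by
        change T.horo r (p n) ↔ (T.lev t - T.lev r).toNat = n
        rw [T.horo_iff_lev, hlev]
        omega
      by_cases hn : r ∈ {r | T.horo r (p n)}
      · rw [Set.indicator_of_mem hn, Set.indicator_of_mem (hiff.1 hn)]
      · rw [Set.indicator_of_notMem hn, Set.indicator_of_notMem (fun h => hn (hiff.2 h)), zero_mul]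
  · intro w hw
    rw [mul_apply_eq_comp]
    refine T.star_word_apply_of_notMem _ fun ⟨s, hs⟩ => hw ⟨w.length, ?_⟩
    exact (T.act_eq_act (he _) ((hp _).trans hs.symm)).1

/-! ### Hilbert–Schmidt and causal operators under the shifts -/

theorem isHilbertSchmidt_constPart {F : Op V} (hF : IsHilbertSchmidt F) :
    IsHilbertSchmidt (T.constPart F) := by
  refine Summable.of_nonneg_of_le (fun t => by positivity) (fun t => ?_) hF
  rw [constPart_chi]
  gcongr
  exact norm_proj_le _ _

theorem isHilbertSchmidt_sub {F G : Op V} (hF : IsHilbertSchmidt F) (hG : IsHilbertSchmidt G) :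
    IsHilbertSchmidt (F - G) :=
  isHilbertSchmidt_of_memℓp (hF.memℓp.sub hG.memℓp)

theorem alpha_chi_shift (j : Fin q) (t : V) : T.alpha j (chi (T.shift j t)) = chi t := by
  rw [alpha_eq_word]
  exact T.word_chi_act [j] t

theorem alpha_chi_of_notMem {j : Fin q} {t : V} (h : t ∉ Set.range (T.shift j)) :
    T.alpha j (chi t) = 0 := by
  rw [alpha_eq_word]
  exact T.word_chi_of_notMem (w := [j]) h

theorem star_alpha_chi (j : Fin q) (t : V) :
    star (T.alpha j) (chi t) = chi (T.shift j t) := by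
  rw [alpha_eq_word]
  exact T.star_word_chi [j] t

theorem isHilbertSchmidt_mul_alpha {F : Op V} (hF : IsHilbertSchmidt F) (j : Fin q) :
    IsHilbertSchmidt (F * T.alpha j) := by
  unfold IsHilbertSchmidt
  rw [← (T.shift_injective j).summable_iff]
  · refine hF.congr fun t => ?_
    rw [Function.comp_apply, mul_apply_eq_comp, alpha_chi_shift]
  · intro t ht
    rw [mul_apply_eq_comp, T.alpha_chi_of_notMem ht, map_zero, norm_zero]
    simp

theorem isHilbertSchmidt_mul_star_alpha {F : Op V} (hF : IsHilbertSchmidt F) (j : Fin q) :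
    IsHilbertSchmidt (F * star (T.alpha j)) := by
  refine (hF.comp_injective (T.shift_injective j)).congr fun t => ?_
  rw [Function.comp_apply, mul_apply_eq_comp, star_alpha_chi]

theorem causal_star_alpha (j : Fin q) : T.Causal (star (T.alpha j)) := by
  rw [alpha_eq_word]
  exact T.causal_star_word [j]

theorem sub_constPart_chi_of_lt (F : Op V) {t r : V} (h : T.lev t < T.lev r) :
    (F - T.constPart F) (chi t) r = F (chi t) r := by
  rw [sub_apply]
  change F (chi t) r - T.constPart F (chi t) r = _
  rw [T.constPart_chi_of_ne F h.ne', sub_zero]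

theorem sub_constPart_chi_of_le {F : Op V} (hF : T.Causal F) {t r : V} (h : T.lev r ≤ T.lev t) :
    (F - T.constPart F) (chi t) r = 0 := by
  rw [sub_apply]
  change F (chi t) r - T.constPart F (chi t) r = 0
  rcases h.eq_or_lt with h | h
  · rw [T.constPart_chi_of_eq F h, sub_self]
  · rw [T.constPart_chi_of_ne F h.ne, T.causal_iff.1 hF t r h, sub_zero]

/-- Right multiplication by `α_j` moves the column at `s` to `s α_j`, one level up. Triangularity
survives only because the entries on the level of `s` have been removed first. -/
theorem causal_sub_constPart_mul_alpha {F : Op V} (hF : T.Causal F) (j : Fin q) :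
    T.Causal ((F - T.constPart F) * T.alpha j) := by
  rw [causal_iff]
  intro t r h
  rw [mul_apply_eq_comp]
  by_cases ht : t ∈ Set.range (T.shift j)
  · obtain ⟨s, rfl⟩ := ht
    rw [alpha_chi_shift]
    rw [lev_shift] at h
    exact T.sub_constPart_chi_of_le hF (by omega)
  · rw [T.alpha_chi_of_notMem ht, map_zero]
    rfl

/-! ### Right multiplication by the adjoint shifts and the backward shifts -/

namespace HardyTwo

theorem hasSum_inner (F G : T.HardyTwo) :
    HasSum (fun t => ⟪op T F (chi t), op T G (chi t)⟫) ⟪F, G⟫ :=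
  lp.hasSum_inner (columns T F) (columns T G)

/-- Multiplication from the right by `α_j*` on `𝐇₂(𝒯)`. -/
noncomputable def rightMulStar (j : Fin q) : T.HardyTwo →L[ℂ] T.HardyTwo :=
  LinearMap.mkContinuous
    { toFun := fun F => mk (op T F * star (T.alpha j))
        (T.causal_mul F.causal_op (T.causal_star_alpha j))
        (T.isHilbertSchmidt_mul_star_alpha F.isHilbertSchmidt_op j)
      map_add' := fun F G => op_injective (add_mul F.1 G.1 _)
      map_smul' := fun c F => op_injective (smul_mul_assoc c F.1 _) } 1
    (fun F => by
      rw [one_mul]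
      refine (sq_le_sq₀ (norm_nonneg _) (norm_nonneg _)).1 ?_
      -- The columns of `F α_j*` form the subfamily of the columns of `F` at the nodes `t α_j`.
      refine hasSum_le_inj (T.shift j) (T.shift_injective j) (fun t _ => by positivity)
        (fun t => ?_) (hasSum_norm_sq _) (hasSum_norm_sq F)
      change ‖(op T F * star (T.alpha j)) (chi t)‖ ^ 2 ≤ _
      rw [mul_apply_eq_comp, star_alpha_chi])

theorem op_rightMulStar (j : Fin q) (F : T.HardyTwo) :
    op T (rightMulStar T j F) = op T F * star (T.alpha j) := rfl

/-- The plain candidate `F α_j` need not be causal. In the inner product with `G α_j*`, however, the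
column of `G` at `t α_j` vanishes on levels up to that of `t`, so only the entries of `F - F_[∅]`
are seen. -/
theorem star_rightMulStar (j : Fin q) (F : T.HardyTwo) :
    star (rightMulStar T j) F = mk ((op T F - T.constPart (op T F)) * T.alpha j)
      (T.causal_sub_constPart_mul_alpha F.causal_op j)
      (T.isHilbertSchmidt_mul_alpha (isHilbertSchmidt_sub F.isHilbertSchmidt_op
        (T.isHilbertSchmidt_constPart F.isHilbertSchmidt_op)) j) := by
  refine ext_inner_left ℂ fun G => ?_
  refine (inner_star_right (rightMulStar T j) G F).trans ((hasSum_inner T _ _).unique ?_)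
  have h := hasSum_inner T G (mk _ (T.causal_sub_constPart_mul_alpha F.causal_op j)
    (T.isHilbertSchmidt_mul_alpha (isHilbertSchmidt_sub F.isHilbertSchmidt_op
        (T.isHilbertSchmidt_constPart F.isHilbertSchmidt_op)) j))
  rw [← (T.shift_injective j).hasSum_iff] at h
  · refine hasSum_of_eq h fun t => ?_
    rw [Function.comp_apply, op_rightMulStar, op_mk, mul_apply_eq_comp, star_alpha_chi,
      mul_apply_eq_comp, alpha_chi_shift]
    rw [lp.inner_eq_tsum, lp.inner_eq_tsum]
    refine tsum_congr fun r => ?_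
    by_cases hr : T.lev t < T.lev r
    · rw [T.sub_constPart_chi_of_lt _ hr]
    · rw [T.causal_iff.1 G.causal_op (T.shift j t) r (by rw [lev_shift]; omega),
        inner_zero_left, inner_zero_left]
  · intro t ht
    rw [op_mk, mul_apply_eq_comp, T.alpha_chi_of_notMem ht, map_zero, inner_zero_right]

theorem op_star_rightMulStar (j : Fin q) (F : T.HardyTwo) :
    op T (star (rightMulStar T j) F) = (op T F - T.constPart (op T F)) * T.alpha j := by
  rw [star_rightMulStar, op_mk]

/-- The projection of `𝐇₂(𝒯)` onto `𝒞₂`. -/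
noncomputable def constProj : T.HardyTwo →L[ℂ] T.HardyTwo :=
  1 - rightMulStar T ⟨0, T.one_le⟩ * star (rightMulStar T ⟨0, T.one_le⟩)

theorem alpha_mul_star_self (j : Fin q) : T.alpha j * star (T.alpha j) = 1 := by
  rw [alpha_eq_word, word_mul_star_self]

/-- By `α_j α_j* = 1`, a backward shift followed by `N` loses exactly the constant part. The result
is independent of `j`, so the index chosen in `constProj` is immaterial. -/
theorem op_one_sub (j : Fin q) (F : T.HardyTwo) :
    op T ((1 - rightMulStar T j * star (rightMulStar T j)) F) = T.constPart (op T F) := by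
  rw [sub_apply, mul_apply_eq_comp, map_sub, op_rightMulStar, op_star_rightMulStar, mul_assoc,
    alpha_mul_star_self, mul_one, one_apply_eq_self, sub_sub_cancel]

theorem op_constProj (F : T.HardyTwo) : op T (constProj T F) = T.constPart (op T F) :=
  op_one_sub T _ F

theorem one_sub_eq_constProj (j : Fin q) :
    1 - rightMulStar T j * star (rightMulStar T j) = constProj T := by
  ext1 F
  exact op_injective ((op_one_sub T j F).trans (op_constProj T F).symm)

/-- The product `F α_j*` is strictly triangular, so its constant part is zero. -/
theorem rightMulStar_mul_star_mul_self (j : Fin q) :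
    rightMulStar T j * star (rightMulStar T j) * rightMulStar T j = rightMulStar T j := by
  have h : constProj T * rightMulStar T j = 0 := by
    ext1 F
    refine op_injective (op_ext_entry fun t r => ?_)
    rw [mul_apply_eq_comp, op_constProj, op_rightMulStar, zero_apply, map_zero, zero_apply]
    change _ = (0 : ℂ)
    by_cases hr : T.lev r = T.lev t
    · rw [constPart_chi_of_eq T _ hr, mul_apply_eq_comp, star_alpha_chi,
        T.causal_iff.1 F.causal_op _ _ (by rw [lev_shift]; omega)]
    · rw [constPart_chi_of_ne T _ hr]
  rw [← one_sub_eq_constProj T j, sub_mul, one_mul, sub_eq_zero] at h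
  exact h.symm

/-- The iterated backward shift along a word. -/
noncomputable def backwardShift (w : List (Fin q)) (F : T.HardyTwo) : T.HardyTwo :=
  w.foldl (fun G j => star (rightMulStar T j) G) F

@[simp] theorem backwardShift_nil (F : T.HardyTwo) : backwardShift T [] F = F := rfl

theorem backwardShift_append_singleton (w : List (Fin q)) (j : Fin q) (F : T.HardyTwo) :
    backwardShift T (w ++ [j]) F = star (rightMulStar T j) (backwardShift T w F) := by
  simp [backwardShift]

theorem op_backwardShift_chi_of_notMem {w : List (Fin q)} (F : T.HardyTwo) {t : V}
    (h : t ∉ Set.range (T.act w)) : op T (backwardShift T w F) (chi t) = 0 := by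
  induction w using List.reverseRecOn generalizing t with
  | nil => exact absurd ⟨t, rfl⟩ h
  | append_singleton w j ih =>
    rw [backwardShift_append_singleton, op_star_rightMulStar, mul_apply_eq_comp]
    by_cases ht : t ∈ Set.range (T.shift j)
    · obtain ⟨s, rfl⟩ := ht
      rw [alpha_chi_shift, sub_apply, constPart_chi, ih, map_zero, sub_zero]
      rintro ⟨p, rfl⟩
      exact h ⟨p, T.act_append_singleton w j p⟩
    · rw [T.alpha_chi_of_notMem ht, map_zero]

/-- Each backward shift transports a column one level up and deletes its entries on the lowest level
still present. After `|w|` steps the entries at least `|w|` levels above `s` are untouched. -/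
theorem op_backwardShift_chi_act (w : List (Fin q)) (F : T.HardyTwo) {s r : V}
    (h : T.lev s + w.length ≤ T.lev r) :
    op T (backwardShift T w F) (chi (T.act w s)) r = op T F (chi s) r := by
  induction w using List.reverseRecOn with
  | nil => rfl
  | append_singleton w j ih =>
    rw [List.length_append, List.length_singleton] at h
    push_cast at h
    rw [backwardShift_append_singleton, op_star_rightMulStar, mul_apply_eq_comp,
      act_append_singleton, alpha_chi_shift, T.sub_constPart_chi_of_lt _ (by rw [lev_act]; omega),
      ih (by omega)]

/-- The constant part of the iterated backward shift is given by the coefficients. -/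
theorem op_constProj_backwardShift (F : T.HardyTwo) (w : List (Fin q)) :
    op T (constProj T (backwardShift T w F)) = ∑ v : List.Vector (Fin q) w.length,
      star (T.word v.1) * T.coeff (op T F) v.1 * T.word w := by
  refine op_ext_entry fun t r => ?_
  rw [op_constProj, ← Finset.sum_mul, mul_apply_eq_comp]
  by_cases ht : t ∈ Set.range (T.act w)
  · obtain ⟨s, rfl⟩ := ht
    -- The row node is the end of exactly one word of length `|w|`, so only the summand of that word
    -- contributes to the entry.
    obtain ⟨v, p, hv, rfl⟩ := T.exists_act w.length r
    rw [word_chi_act]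
    refine Eq.trans ?_ ((sum_op_apply_apply _ _ _ _).trans
      (Finset.sum_eq_single (⟨v, hv⟩ : List.Vector (Fin q) w.length) ?_ ?_)).symm
    · rw [mul_apply_eq_comp, star_word_apply_act]
      by_cases hp : T.lev p = T.lev s
      · rw [coeff_chi_of_eq T _ _ hp, constPart_chi_of_eq T _ (by simp only [lev_act]; omega),
          op_backwardShift_chi_act T w F (by rw [lev_act]; omega)]
      · rw [coeff, constPart_chi_of_ne T _ hp,
          constPart_chi_of_ne T _ (by simp only [lev_act]; omega)]
    · rintro ⟨u, hu⟩ - hne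
      rw [mul_apply_eq_comp]
      refine T.star_word_apply_of_notMem _ fun ⟨x, hx⟩ => hne (Subtype.ext ?_)
      exact (T.act_eq_act (hu.trans hv.symm) hx).1
    · intro h
      exact (h (Finset.mem_univ (α := List.Vector (Fin q) w.length) ⟨v, hv⟩)).elim
  · rw [T.word_chi_of_notMem ht, map_zero, constPart_chi,
      op_backwardShift_chi_of_notMem T F ht, map_zero]

/-- The constant part of an element of `𝐇₂(𝒯)`. -/
noncomputable def toConst : T.HardyTwo →L[ℂ] T.constTwo :=
  (constProj T).codRestrict T.constTwo fun F => by
    change T.IsConst (op T (constProj T F))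
    rw [op_constProj]
    exact T.isConst_constPart _

theorem constOp_toConst (F : T.HardyTwo) : T.constOp (toConst T F) = T.constPart (op T F) :=
  op_constProj T F

theorem constProj_const (d : T.constTwo) : constProj T d = d :=
  op_injective ((op_constProj T d).trans (T.constPart_eq_self d.2))

theorem constOp_injective : Function.Injective T.constOp :=
  fun _ _ h => Subtype.ext (op_injective h)

/-- The coefficients in `𝒞₂` of an element of `𝐇₂(𝒯)` exist and are unique. -/
theorem existsUnique_isExpansion (F : T.HardyTwo) :
    ∃! a : List (Fin q) → T.constTwo, T.IsExpansion (op T F) fun w => T.constOp (a w) := by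
  have hs : ∀ w, IsHilbertSchmidt (T.coeff (op T F) w) := fun w =>
    T.isHilbertSchmidt_constPart (isHilbertSchmidt_mul _ F.isHilbertSchmidt_op)
  have hc : ∀ w, T.IsConst (T.coeff (op T F) w) := fun w => T.isConst_constPart _
  refine ⟨fun w => ⟨mk (T.coeff (op T F) w) (hc w).1 (hs w), hc w⟩,
    T.isExpansion_coeff F.causal_op, fun b hb => ?_⟩
  exact funext fun w => constOp_injective T (IsExpansion.eq_coeff T hb w)

end HardyTwo
end MultiscaleTree

namespace MultiscaleTree

variable {q : ℕ} {V : Type*} {T : MultiscaleTree q V}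

/-! ### The defect operator and its commutation with the backward shifts -/

namespace SchurMultiplier

open HardyTwo

variable (S : T.SchurMultiplier)

theorem star_sqrtDefect : star S.sqrtDefect = S.sqrtDefect :=
  (CFC.sqrt_nonneg S.defect).isSelfAdjoint.star_eq

theorem norm_sq_sqrtDefect (F : T.HardyTwo) :
    ‖S.sqrtDefect F‖ ^ 2 = ‖F‖ ^ 2 - ‖star S.mulLeft F‖ ^ 2 := by
  have h1 : S.sqrtDefect * S.sqrtDefect = S.defect := CFC.sqrt_mul_sqrt_self _ S.defect_nonneg
  have h2 : ⟪S.sqrtDefect F, S.sqrtDefect F⟫ = ⟪F, F⟫ - ⟪star S.mulLeft F, star S.mulLeft F⟫ := by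
    calc ⟪S.sqrtDefect F, S.sqrtDefect F⟫ = ⟪star S.sqrtDefect F, S.sqrtDefect F⟫ := by
          rw [star_sqrtDefect]
      _ = ⟪F, (S.sqrtDefect * S.sqrtDefect) F⟫ := inner_star_left _ _ _
      _ = ⟪F, F - S.mulLeft (star S.mulLeft F)⟫ := by rw [h1]; rfl
      _ = ⟪F, F⟫ - ⟪F, S.mulLeft (star S.mulLeft F)⟫ := inner_sub_right _ _ _
      _ = _ := congrArg (⟪F, F⟫ - ·) (inner_star_left S.mulLeft F _).symm
  have h3 : ∀ G : T.HardyTwo, ⟪G, G⟫ = (‖G‖ : ℂ) ^ 2 := fun G => inner_self_eq_norm_sq_to_K G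
  rw [h3, h3, h3] at h2
  exact_mod_cast h2

theorem norm_sqrtDefect_le (F : T.HardyTwo) : ‖S.sqrtDefect F‖ ≤ ‖F‖ := by
  refine (sq_le_sq₀ (norm_nonneg _) (norm_nonneg _)).1 ?_
  rw [norm_sq_sqrtDefect]
  have := sq_nonneg ‖star S.mulLeft F‖
  linarith

theorem mulLeft_mul_rightMulStar (j : Fin q) :
    S.mulLeft * rightMulStar T j = rightMulStar T j * S.mulLeft := by
  ext1 F
  exact op_injective (mul_assoc S.op (HardyTwo.op T F) (star (T.alpha j))).symm

theorem op_star_mul_rightMulStar (j : Fin q) (F : T.HardyTwo) :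
    HardyTwo.op T ((star (rightMulStar T j) * rightMulStar T j) F) =
      HardyTwo.op T F * star (T.alpha j) * T.alpha j := by
  have h : T.constPart (HardyTwo.op T (rightMulStar T j F)) = 0 := by
    rw [← op_constProj, ← one_sub_eq_constProj T j, ← mul_apply_eq_comp, sub_mul, one_mul,
      rightMulStar_mul_star_mul_self, sub_self, zero_apply, map_zero]
  rw [mul_apply_eq_comp, op_star_rightMulStar, h, sub_zero, op_rightMulStar]

/-- `N* N` is right multiplication by `α_j* α_j`, which commutes with left multiplication by `S` by
associativity. -/
theorem star_mul_rightMulStar_comm (j : Fin q) :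
    star (rightMulStar T j) * rightMulStar T j * S.mulLeft =
      S.mulLeft * (star (rightMulStar T j) * rightMulStar T j) := by
  ext1 F
  refine op_injective ?_
  rw [mul_apply_eq_comp, op_star_mul_rightMulStar, mul_apply_eq_comp, op_mulLeft, op_mulLeft,
    op_star_mul_rightMulStar]
  simp only [mul_assoc]

/-- The estimate which makes the backward shifts contractions on `𝐇(S)`. -/
theorem norm_sq_sqrtDefect_rightMulStar_add_le (j : Fin q) (F : T.HardyTwo) :
    ‖S.sqrtDefect (rightMulStar T j F)‖ ^ 2 +
      ‖constProj T (star S.mulLeft (rightMulStar T j F))‖ ^ 2 ≤ ‖S.sqrtDefect F‖ ^ 2 := by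
  rw [norm_sq_sqrtDefect, norm_sq_sqrtDefect, ← one_sub_eq_constProj T j]
  exact shift_defect_add_le S.norm_mulLeft_le (S.mulLeft_mul_rightMulStar j)
    (S.star_mul_rightMulStar_comm j) (rightMulStar_mul_star_mul_self T j) F

theorem norm_sub_projKer_le (F : T.HardyTwo) : ‖F - S.projKer F‖ ≤ ‖F‖ := by
  have h : F - S.projKer F = S.defect.kerᗮ.starProjection F := by
    rw [Submodule.starProjection_orthogonal_val]
    rfl
  rw [h]
  exact Submodule.norm_starProjection_apply_le _ _

theorem sqrtDefect_sub_projKer (F : T.HardyTwo) :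
    S.sqrtDefect (F - S.projKer F) = S.sqrtDefect F := by
  have h : S.projKer F ∈ S.defect.ker := Submodule.starProjection_apply_mem _ _
  rw [map_sub, (S.sqrtDefect_eq_zero_iff _).2 h, sub_zero]

/-! ### The blocks of the realization on the de Branges–Rovnyak space -/

namespace DeBrangesRovnyak

theorem incl_injective : Function.Injective (incl S) := Subtype.val_injective

/-- Removing the component in the kernel of the defect changes neither the image under `√𝓑_S` nor
the element, and makes the norm of the preimage equal to that of the element. -/
theorem exists_eq_sqrtDefect (x : S.DeBrangesRovnyak) :
    ∃ F : T.HardyTwo, incl S x = S.sqrtDefect F ∧ ‖x‖ = ‖F‖ := by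
  obtain ⟨F, hF⟩ : ∃ F, S.sqrtDefect F = incl S x := x.2
  have hx : x = ofSqrt S F := incl_injective S hF.symm
  refine ⟨F - S.projKer F, ?_, ?_⟩
  · rw [sqrtDefect_sub_projKer, hF]
  · rw [hx, norm_ofSqrt]

/-- The contractive inclusion of `𝐇(S)` into `𝐇₂(𝒯)`. -/
noncomputable def inclL : S.DeBrangesRovnyak →L[ℂ] T.HardyTwo :=
  (incl S).mkContinuous 1 fun x => by
    obtain ⟨F, h1, h2⟩ := exists_eq_sqrtDefect S x
    rw [h1, h2, one_mul]
    exact S.norm_sqrtDefect_le F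

/-- Membership in the de Branges–Rovnyak space by duality. Passing to the norm of that space only
discards the kernel component of the preimage, so the bound `c` is kept. -/
theorem exists_incl_eq {y : T.HardyTwo} {c : ℝ} (hc : 0 ≤ c)
    (h : ∀ z, ‖⟪y, z⟫‖ ≤ c * ‖S.sqrtDefect z‖) : ∃ x, incl S x = y ∧ ‖x‖ ≤ c := by
  obtain ⟨F, h1, h2⟩ := exists_preimage_of_inner_le S.star_sqrtDefect hc h
  exact ⟨ofSqrt S F, h1, (norm_ofSqrt S F).trans_le ((S.norm_sub_projKer_le F).trans h2)⟩

/-- A contraction into `𝐇(S)` from an operator into `𝐇₂(𝒯)` dominated by `√𝓑_S`. -/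
noncomputable def factor {W : Type*} [NormedAddCommGroup W] [NormedSpace ℂ W]
    (K : W →L[ℂ] T.HardyTwo) (h : ∀ x z, ‖⟪K x, z⟫‖ ≤ ‖x‖ * ‖S.sqrtDefect z‖) :
    W →L[ℂ] S.DeBrangesRovnyak :=
  LinearMap.mkContinuous
    { toFun := fun x => Classical.choose (exists_incl_eq S (norm_nonneg x) (h x))
      map_add' := fun x y => incl_injective S <|
        (Classical.choose_spec (exists_incl_eq S (norm_nonneg (x + y)) (h (x + y)))).1.trans <| by
          rw [map_add (incl S), map_add K,
            (Classical.choose_spec (exists_incl_eq S (norm_nonneg x) (h x))).1,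
            (Classical.choose_spec (exists_incl_eq S (norm_nonneg y) (h y))).1]
      map_smul' := fun c x => incl_injective S <|
        (Classical.choose_spec (exists_incl_eq S (norm_nonneg (c • x)) (h (c • x)))).1.trans <| by
          rw [map_smul (incl S), map_smul K,
            (Classical.choose_spec (exists_incl_eq S (norm_nonneg x) (h x))).1, RingHom.id_apply] } 1
    fun x => by
      rw [one_mul]
      exact (Classical.choose_spec (exists_incl_eq S (norm_nonneg x) (h x))).2

theorem incl_factor {W : Type*} [NormedAddCommGroup W] [NormedSpace ℂ W]
    (K : W →L[ℂ] T.HardyTwo) (h : ∀ x z, ‖⟪K x, z⟫‖ ≤ ‖x‖ * ‖S.sqrtDefect z‖) (x : W) :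
    incl S (factor S K h x) = K x :=
  (Classical.choose_spec (exists_incl_eq S (norm_nonneg x) (h x))).1

/-- The main operator `A_j`. -/
noncomputable def stateOp (j : Fin q) : S.DeBrangesRovnyak →L[ℂ] S.DeBrangesRovnyak :=
  factor S (star (rightMulStar T j) ∘L inclL S) fun x z => by
    obtain ⟨F, h1, h2⟩ := exists_eq_sqrtDefect S x
    -- By duality the claim becomes a bound of `√𝓑_S N z` by `√𝓑_S z`, the first summand of the
    -- contraction estimate.
    have e : ⟪star (rightMulStar T j) (incl S x), z⟫ =
        ⟪F, S.sqrtDefect (rightMulStar T j z)⟫ := by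
      rw [h1]
      refine (inner_star_left _ _ _).trans ?_
      refine Eq.trans ?_ (inner_star_left S.sqrtDefect F (rightMulStar T j z))
      rw [star_sqrtDefect]
    refine (congrArg norm e).trans_le ((norm_inner_le_norm _ _).trans ?_)
    rw [h2]
    gcongr
    refine (sq_le_sq₀ (norm_nonneg _) (norm_nonneg _)).1 ?_
    exact (le_add_of_nonneg_right (sq_nonneg _)).trans
      (S.norm_sq_sqrtDefect_rightMulStar_add_le j z)

theorem incl_stateOp (j : Fin q) (x : S.DeBrangesRovnyak) :
    incl S (stateOp S j x) = star (rightMulStar T j) (incl S x) :=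
  incl_factor S _ _ x

/-- The input operator `B_j`. -/
noncomputable def inputOp (j : Fin q) : T.constTwo →L[ℂ] S.DeBrangesRovnyak :=
  factor S ((star (rightMulStar T j) * S.mulLeft) ∘L T.constTwo.subtypeL) fun d z => by
    have hE : star (constProj T) = constProj T := by
      rw [constProj, star_sub, star_mul, star_star, star_one]
    -- Since `d` is constant, `E` may be inserted, and the second summand of the same estimate gives
    -- the bound.
    have e : ⟪star (rightMulStar T j) (S.mulLeft d), z⟫ =
        ⟪(d : T.HardyTwo), constProj T (star S.mulLeft (rightMulStar T j z))⟫ := by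
      calc ⟪star (rightMulStar T j) (S.mulLeft d), z⟫
          = ⟪S.mulLeft d, rightMulStar T j z⟫ := inner_star_left _ _ _
        _ = ⟪(d : T.HardyTwo), star S.mulLeft (rightMulStar T j z)⟫ :=
            (inner_star_right _ _ _).symm
        _ = ⟪constProj T d, star S.mulLeft (rightMulStar T j z)⟫ := by rw [constProj_const]
        _ = ⟪star (constProj T) d, star S.mulLeft (rightMulStar T j z)⟫ := by rw [hE]
        _ = _ := inner_star_left _ _ _
    refine (congrArg norm e).trans_le ((norm_inner_le_norm _ _).trans ?_)
    refine mul_le_mul_of_nonneg_left ?_ (norm_nonneg _)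
    refine (sq_le_sq₀ (norm_nonneg _) (norm_nonneg _)).1 ?_
    exact (le_add_of_nonneg_left (sq_nonneg _)).trans
      (S.norm_sq_sqrtDefect_rightMulStar_add_le j z)

theorem incl_inputOp (j : Fin q) (d : T.constTwo) :
    incl S (inputOp S j d) = star (rightMulStar T j) (S.mulLeft d) :=
  incl_factor S _ _ d

end DeBrangesRovnyak

/-- The state at a node of the realization, in terms of the iterated backward shifts of the input
and the output. -/
theorem incl_state_eq (U : T.HardyTwo) {X : List (Fin q) → S.DeBrangesRovnyak} (h0 : X [] = 0)
    (hX : ∀ w j, X (w ++ [j]) = DeBrangesRovnyak.stateOp S j (X w) +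
      DeBrangesRovnyak.inputOp S j (toConst T (backwardShift T w U))) (w : List (Fin q)) :
    DeBrangesRovnyak.incl S (X w) =
      backwardShift T w (S.mulLeft U) - S.mulLeft (backwardShift T w U) := by
  induction w using List.reverseRecOn with
  | nil => rw [h0, map_zero, backwardShift_nil, backwardShift_nil, sub_self]
  | append_singleton w j ih =>
    -- The error term `N* M E` of the commutation identity, applied to the shifted input, is
    -- precisely the contribution of the input operator.
    have h := congrArg (fun K : T.HardyTwo →L[ℂ] T.HardyTwo => K (backwardShift T w U))
      (star_mul_eq_add (S.mulLeft_mul_rightMulStar j) (S.star_mul_rightMulStar_comm j)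
        (rightMulStar_mul_star_mul_self T j))
    rw [one_sub_eq_constProj] at h
    have h' : star (rightMulStar T j) (S.mulLeft (backwardShift T w U)) =
        S.mulLeft (star (rightMulStar T j) (backwardShift T w U)) +
          star (rightMulStar T j) (S.mulLeft (constProj T (backwardShift T w U))) := h
    rw [hX, map_add, DeBrangesRovnyak.incl_stateOp, DeBrangesRovnyak.incl_inputOp, ih, map_sub, h',
      backwardShift_append_singleton, backwardShift_append_singleton]
    change _ + star (rightMulStar T j) (S.mulLeft (constProj T (backwardShift T w U))) = _
    abel

theorem constProj_mulLeft_constProj (F : T.HardyTwo) :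
    constProj T (S.mulLeft (constProj T F)) = constProj T (S.mulLeft F) := by
  have h := congrArg (fun K : T.HardyTwo →L[ℂ] T.HardyTwo => K F)
    (one_sub_mul_mul_self (S.mulLeft_mul_rightMulStar ⟨0, T.one_le⟩)
      (rightMulStar_mul_star_mul_self T ⟨0, T.one_le⟩))
  rw [one_sub_eq_constProj] at h
  exact h

end SchurMultiplier

end MultiscaleTree

theorem exists_list_recursion {α β : Type*} (b : β) (g : List α → α → β → β) :
    ∃ X : List α → β, X [] = b ∧ ∀ w j, X (w ++ [j]) = g w j (X w) :=
  ⟨fun w => List.reverseRecOn w b fun w j x => g w j x, by simp, fun w j => by simp⟩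

end Multiscale

/-! ### The realization theorem -/

open Multiscale
theorem theorem6p7 {q : ℕ} {V : Type*} (T : MultiscaleTree q V) (S : T.SchurMultiplier) :
    ∃ (A : Fin q → (S.DeBrangesRovnyak →L[ℂ] S.DeBrangesRovnyak))
      (B : Fin q → (T.constTwo →L[ℂ] S.DeBrangesRovnyak))
      (C : S.DeBrangesRovnyak →L[ℂ] T.constTwo)
      (D : T.constTwo →L[ℂ] T.constTwo),
      -- the blocks of `V_j`
      (∀ (j : Fin q) (F : S.DeBrangesRovnyak),
        (A j F).op = (F.op - T.pointEval F.op 0) * T.alpha j) ∧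
      (∀ (j : Fin q) (d : T.constTwo),
        (B j d).op = (S.op - T.pointEval S.op 0) * T.constOp d * T.alpha j) ∧
      (∀ F : S.DeBrangesRovnyak, T.constOp (C F) = T.pointEval F.op 0) ∧
      (∀ d : T.constTwo, T.constOp (D d) = T.pointEval S.op 0 * T.constOp d) ∧
      -- the input `U` and the output `Y = S U`
      ∀ U Y : T.HardyTwo, Y = S.mulLeft U →
        -- the coefficients of both expansions exist and are unique
        (∃! u : List (Fin q) → T.constTwo,
          T.IsExpansion (MultiscaleTree.HardyTwo.op T U) (fun w => T.constOp (u w))) ∧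
        (∃! y : List (Fin q) → T.constTwo,
          T.IsExpansion (MultiscaleTree.HardyTwo.op T Y) (fun w => T.constOp (y w))) ∧
        ∀ u y : List (Fin q) → T.constTwo,
          T.IsExpansion (MultiscaleTree.HardyTwo.op T U) (fun w => T.constOp (u w)) →
          T.IsExpansion (MultiscaleTree.HardyTwo.op T Y) (fun w => T.constOp (y w)) →
          ∃ (Uin : List (Fin q) → T.constTwo) (X : List (Fin q) → S.DeBrangesRovnyak),
            (∀ w, T.constOp (Uin w) = ∑ v : List.Vector (Fin q) w.length,
              star (T.word v.1) * T.constOp (u v.1) * T.word w) ∧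
            X [] = 0 ∧
            (∀ w j, X (w ++ [j]) = A j (X w) + B j (Uin w)) ∧
            ∀ w v : List (Fin q), v.length = w.length →
              T.constOp (y w) =
                T.word w * T.constOp (C (X v) + D (Uin v)) * star (T.word v) := by
  open MultiscaleTree HardyTwo SchurMultiplier DeBrangesRovnyak in
  refine ⟨stateOp S, inputOp S, toConst T ∘L inclL S,
    toConst T ∘L S.mulLeft ∘L T.constTwo.subtypeL, fun j F => ?_, fun j d => ?_, fun F => ?_,
    fun d => ?_, ?_⟩
  · rw [T.pointEval_zero]
    exact (congrArg (HardyTwo.op T) (incl_stateOp S j F)).trans (op_star_rightMulStar T j _)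
  -- As `(S d)_[∅] = S_[∅] d` for a constant `d`, the required formula is the backward shift of `S
  -- d`.
  · rw [T.pointEval_zero, sub_mul, ← T.constPart_mul_const _ (show T.IsConst (T.constOp d) from d.2)]
    exact (congrArg (HardyTwo.op T) (incl_inputOp S j d)).trans (op_star_rightMulStar T j _)
  · rw [T.pointEval_zero]
    exact constOp_toConst T _
  · rw [T.pointEval_zero]
    exact (constOp_toConst T _).trans (T.constPart_mul_const _ d.2)
  rintro U Y rfl
  refine ⟨existsUnique_isExpansion T U, existsUnique_isExpansion T _, fun u y hu hy => ?_⟩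
  obtain ⟨X, h0, hX⟩ := exists_list_recursion (0 : S.DeBrangesRovnyak) fun w j x =>
    stateOp S j x + inputOp S j (toConst T (backwardShift T w U))
  refine ⟨fun w => toConst T (backwardShift T w U), X, fun w => ?_, h0, hX, fun w v hvw => ?_⟩
  · refine (op_constProj_backwardShift T U w).trans (Finset.sum_congr rfl fun v _ => ?_)
    rw [hu.eq_coeff]
  -- The term `E S Z_v U` coming from the state cancels against `D U_v = E S E Z_v U`, which leaves
  -- the constant part of the shifted output.
  · have h1 : toConst T (incl S (X v)) + toConst T (S.mulLeft (toConst T (backwardShift T v U))) =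
        toConst T (backwardShift T v (S.mulLeft U)) := by
      rw [incl_state_eq S U h0 hX v, map_sub]
      have : toConst T (S.mulLeft (toConst T (backwardShift T v U))) =
          toConst T (S.mulLeft (backwardShift T v U)) :=
        Subtype.ext (S.constProj_mulLeft_constProj _)
      rw [this, sub_add_cancel]
    have h2 : T.constOp (toConst T (backwardShift T v (S.mulLeft U))) =
        ∑ v' : List.Vector (Fin q) v.length,
          star (T.word v'.1) * T.coeff (HardyTwo.op T (S.mulLeft U)) v'.1 * T.word v :=
      op_constProj_backwardShift T (S.mulLeft U) v
    refine Eq.trans ?_ (congrArg (fun d => T.word w * T.constOp d * star (T.word v)) h1).symm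
    -- The factor `v v* = 1` disappears on the right; on the left, `w` annihilates every `w'*` of
    -- the same length except `w' = w`.
    rw [h2, hy.eq_coeff, mul_assoc, ← Finset.sum_mul, mul_assoc _ (T.word v), word_mul_star_self,
      mul_one, Finset.mul_sum]
    refine Eq.trans ?_
      (Finset.sum_eq_single (⟨w, hvw.symm⟩ : List.Vector (Fin q) v.length) ?_ ?_).symm
    · rw [← mul_assoc, word_mul_star_self, one_mul]
    · rintro ⟨w', hw'⟩ - hne
      rw [← mul_assoc, T.word_mul_star_of_ne (hvw.symm.trans hw'.symm)
        (fun e => hne (Subtype.ext e.symm)), zero_mul]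
    · exact fun h => (h (Finset.mem_univ (α := List.Vector (Fin q) v.length) ⟨w, hvw.symm⟩)).elim
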